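/- All varieties are over $\mathbb C$. For $n\ge 0$ let $BF_n\subset\prod_{k=1}^n\mathbb P^k$ be the bounded flag variety: the set of tuples $(z_1,\dots,z_n)$, $z_k=[z_{k,0}:\dots:z_{k,k}]$, such that for $2\le k\le n$ all $2\times2$ minors of the matrix with rows $(z_{k,0},\dots,z_{k,k-1})$ and $(z_{k-1,0},\dots,z_{k-1,k-1})$ vanish. (Equivalently, the tuples of lines $l_k\subset\mathbb C\langle e_0,\dots,e_k\rangle$ with $l_k\subset l_{k-1}\oplus\mathbb C e_k$, where $l_0=\mathbb C e_0$; $BF_0$ is a point, with $z_0=[1]$.) For $i,j\ge 0$ let $R_{i,j}\subset BF_i\times BF_j$ be the hypersurface of pairs $(z_1,\dots,z_i;w_1,\dots,w_j)$ satisfying $$\sum_{k=0}^{\min\{i,j\}} z_{i,i-k}\,w_{j,j-k}=0 .$$ A morphism of varieties $p:E\to B$ is called an algebraic fibre bundle with fibre $F$ if every point of $B$ has a Zariski open neighbourhood $U$ with an isomorphism of varieties $p^{-1}(U)\cong U\times F$ over $U$. **Theorem.** (i) Let $i\ge j+1$, $j\geq 0$. Then $$p:R_{i,j}\to BF_{i-j-1},\qquad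 (z_1,\dots,z_i,w_1,\dots,w_j)\mapsto(z_1,\dots,z_{i-j-1})$$ is an algebraic fibre bundle with fibre $R_{j+1,j}$. (ii) Let $i\ge 1$. Then the maps $p_1,p_2:R_{i,i}\to\mathbb P^1$, which send $(z_1,\dots,z_i,w_1,\dots,w_i)$ to $z_1$ and to $w_1$ respectively, are algebraic fibre bundles with fibres $R_{i-1,i}$ and $R_{i,i-1}$ respectively. -/

import Mathlib

noncomputable section

namespace RayVar

/-- The product `∏ₐ ℙ^{n a}` of complex projective spaces. -/
def MultiProj {ι : Type} (n : ι → ℕ) : Type :=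
  ∀ a, Projectivization ℂ (Fin (n a + 1) → ℂ)

namespace MultiProj

/-- Homogeneous coordinates of the `a`-th component of a point, for a chosen representative.
They are only used in conditions that do not depend on the representative. -/
def coord {ι : Type} {n : ι → ℕ} (x : MultiProj n) (a : ι) (k : Fin (n a + 1)) : ℂ :=
  (x a).rep k

/-- The value of a polynomial in all the homogeneous coordinates (at the chosen representatives). -/
def evalAt {ι : Type} {n : ι → ℕ} (x : MultiProj n)
    (F : MvPolynomial (Σ a, Fin (n a + 1)) ℂ) : ℂ :=
  MvPolynomial.eval (fun s => x.coord s.1 s.2) F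

/-- First component of a point of a product of two multiprojective spaces. -/
def fst {ι κ : Type} {n : ι → ℕ} {m : κ → ℕ} (x : MultiProj (Sum.elim n m)) : MultiProj n :=
  fun a => x (Sum.inl a)

/-- Second component of a point of a product of two multiprojective spaces. -/
def snd {ι κ : Type} {n : ι → ℕ} {m : κ → ℕ} (x : MultiProj (Sum.elim n m)) : MultiProj m :=
  fun b => x (Sum.inr b)

end MultiProj

/-- `F` is multihomogeneous of multidegree `d`: homogeneous of degree `d a` in the coordinates
of the `a`-th projective space, for every `a`. -/
def IsMultiHomogeneous {ι : Type} {n : ι → ℕ}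
    (F : MvPolynomial (Σ a, Fin (n a + 1)) ℂ) (d : ι → ℕ) : Prop :=
  ∀ s ∈ F.support, ∀ a, ∑ k : Fin (n a + 1), s ⟨a, k⟩ = d a

/-- The Zariski topology on a product of projective spaces, with the non-vanishing loci of
multihomogeneous polynomials as basic open sets. Subsets carry the induced topology. -/
instance {ι : Type} {n : ι → ℕ} : TopologicalSpace (MultiProj n) :=
  TopologicalSpace.generateFrom
    {U | ∃ F d, IsMultiHomogeneous F d ∧ U = {x : MultiProj n | x.evalAt F ≠ 0}}

/-- Regular maps (morphisms) between locally closed subvarieties of products of projective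
spaces: locally in the Zariski topology, each component of the map is given by multihomogeneous
polynomials of one common multidegree, without common zeros. -/
def IsRegular {ι κ : Type} {n : ι → ℕ} {m : κ → ℕ} {X : Set (MultiProj n)}
    {Y : Set (MultiProj m)} (f : X → Y) : Prop :=
  ∀ (x : X) (b : κ), ∃ V : Set X, IsOpen V ∧ x ∈ V ∧
    ∃ (F : Fin (m b + 1) → MvPolynomial (Σ a, Fin (n a + 1)) ℂ) (d : ι → ℕ),
      (∀ k, IsMultiHomogeneous (F k) d) ∧
      ∀ y ∈ V, ∃ h : (fun k => y.1.evalAt (F k)) ≠ 0,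
        (f y).1 b = Projectivization.mk ℂ (fun k => y.1.evalAt (F k)) h

/-- The product of two subvarieties. -/
def prodVar {ι κ : Type} {n : ι → ℕ} {m : κ → ℕ} (X : Set (MultiProj n))
    (Y : Set (MultiProj m)) : Set (MultiProj (Sum.elim n m)) :=
  {x | x.fst ∈ X ∧ x.snd ∈ Y}

/-- The preimage `p⁻¹(U)`, as a subset of the projective space containing the source of `p`. -/
def preimageVar {ι κ : Type} {n : ι → ℕ} {m : κ → ℕ} {E : Set (MultiProj n)}
    {B : Set (MultiProj m)} (p : E → B) (U : Set (MultiProj m)) : Set (MultiProj n) :=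
  {x | ∃ h : x ∈ E, (p ⟨x, h⟩).1 ∈ U}

/-- `p : E → B` is an algebraic fibre bundle with fibre `F`: `p` is a morphism, and `B` is covered
by Zariski open sets `B ∩ U` over which there is an isomorphism of varieties
`φ : p⁻¹(U) ≃ (B ∩ U) × F` whose first component is `p`. -/
def IsAlgFibreBundle {ι κ τ : Type} {n : ι → ℕ} {m : κ → ℕ} {q : τ → ℕ}
    {E : Set (MultiProj n)} {B : Set (MultiProj m)} (p : E → B) (F : Set (MultiProj q)) : Prop :=
  IsRegular p ∧
  ∀ b : B, ∃ U : Set (MultiProj m), IsOpen U ∧ b.1 ∈ U ∧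
    ∃ φ : preimageVar p U ≃ prodVar (B ∩ U) F,
      IsRegular φ ∧ IsRegular φ.symm ∧
      ∀ x : preimageVar p U, (φ x).1.fst = (p ⟨x.1, x.2.1⟩).1

/-- `∏_{k=0}^n ℙ^k`. The factor `ℙ^0` is a point; it records the line `l₀ = ℂ e₀`. -/
abbrev Flags (n : ℕ) : Type := MultiProj (fun k : Fin (n + 1) => (k : ℕ))

/-- The bounded flag variety `BF_n`: tuples of lines `(l_1, …, l_n)` with `l_k ⊂ l_{k-1} ⊕ ℂ e_k`
and `l_0 = ℂ e_0`. In homogeneous coordinates `z_k = [z_{k,0} : … : z_{k,k}]` of `l_k`: all the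
`2 × 2` minors of the matrix with rows `(z_{k,0}, …, z_{k,k-1})` and `(z_{k-1,0}, …, z_{k-1,k-1})`
vanish. -/
def BF (n : ℕ) : Set (Flags n) :=
  {z | ∀ (k : Fin n) (r s : Fin (k + 1)),
    z.coord k.succ r.castSucc * z.coord k.castSucc s =
      z.coord k.succ s.castSucc * z.coord k.castSucc r}

/-- Ray's hypersurface `R_{i,j} ⊂ BF_i × BF_j`, given by
`∑_{k=0}^{min(i,j)} z_{i,i-k} w_{j,j-k} = 0`. -/
def R (i j : ℕ) : Set (MultiProj (Sum.elim
    (fun k : Fin (i + 1) => (k : ℕ)) (fun k : Fin (j + 1) => (k : ℕ)))) :=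
  {x | x.fst ∈ BF i ∧ x.snd ∈ BF j ∧
    ∑ k : Fin (min i j + 1),
      x.fst.coord (Fin.last i) ⟨i - k, Nat.lt_succ_of_le (Nat.sub_le i k)⟩ *
      x.snd.coord (Fin.last j) ⟨j - k, Nat.lt_succ_of_le (Nat.sub_le j k)⟩ = 0}

/-- The projective line as a variety. -/
def P1 : Set (MultiProj (fun _ : Unit => 1)) := Set.univ

/-- The forgetful map `BF_n → BF_m`, `(z_1, …, z_n) ↦ (z_1, …, z_m)`, for `m ≤ n`. -/
def BF.forget {m n : ℕ} (h : m ≤ n) (z : BF n) : BF m :=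
  ⟨fun k => z.1 (Fin.castLE (Nat.succ_le_succ h) k),
    fun k r s => z.2 (Fin.castLE h k) r s⟩

/-- The map `R_{i,j} → BF_{i-j-1}`, `(z_1, …, z_i, w_1, …, w_j) ↦ (z_1, …, z_{i-j-1})`. -/
def projBF (i j : ℕ) (x : R i j) : BF (i - j - 1) :=
  BF.forget (by omega) ⟨x.1.fst, x.2.1⟩

/-- The map `R_{i,i} → ℙ^1`, `(z_1, …, z_i, w_1, …, w_i) ↦ z_1`, for `i ≥ 1`. -/
def projZ1 (i : ℕ) (hi : 1 ≤ i) (x : R i i) : P1 :=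
  ⟨fun _ => x.1.fst ⟨1, Nat.lt_succ_of_le hi⟩, trivial⟩

/-- The map `R_{i,i} → ℙ^1`, `(z_1, …, z_i, w_1, …, w_i) ↦ w_1`, for `i ≥ 1`. -/
def projW1 (i : ℕ) (hi : 1 ≤ i) (x : R i i) : P1 :=
  ⟨fun _ => x.1.snd ⟨1, Nat.lt_succ_of_le hi⟩, trivial⟩

end RayVar

end

/-!
The three projections are trivialised over the standard charts of their bases by explicit
polynomials in the homogeneous coordinates.

Let `m = i - j - 1` in (i) and `m = 1` in (ii). Each line `l_k` with `k ≥ m` of a bounded flag is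
contained in `l_m ⊕ ℂ⟨e_{m+1}, …, e_k⟩`. On the chart `z_{m,s} ≠ 0` the line `l_m` has the
generator `σ = z_m / z_{m,s}`, so that `l_m, l_{m+1}, …` is a bounded flag for the basis vectors
`σ, e_{m+1}, e_{m+2}, …`; its coordinates are `(z_{k,s}, z_{k,m+1}, …, z_{k,k})` (`upperFlag`).
Together with `l_0, …, l_m` it determines the original flag (`glueFlag`), since
`z_k = z_{k,s} σ + ∑_{r > m} z_{k,r} e_r`.

In (i) the equation of `R_{i,j}` involves only the coordinates of `z_i` with index greater than
`m`, hence it becomes the equation of `R_{j+1,j}` for the upper flag (`pairing_upperFlag`).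

In (ii) the equation of `R_{i,i}` is `∑_r z_{i,r} w_{i,r} = 0`, which reads
`z_{i,s} (σ_0 w_{i,0} + σ_1 w_{i,1}) + ∑_{r ≥ 2} z_{i,r} w_{i,r} = 0`. As `l_1` is an arbitrary
line in the plane spanned by `e_0` and `e_1`, the linear automorphisms of this plane act on
bounded flags. Taking `w_{1-s}` and `σ_0 w_0 + σ_1 w_1` as new coordinates on it (`twist`, with
inverse `untwist`), one obtains the equation of `R_{i-1,i}` (`pairing_upperFlag_twist`). The second
projection is treated in the same way with the roles of `z` and `w` exchanged.

All these maps are multihomogeneous after clearing denominators, and they are inverse to each other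
up to scalars in every factor; `isAlgFibreBundle_of_systems` turns such data into an algebraic fibre
bundle.
-/

namespace RayVar

/-! ### Multihomogeneous polynomials -/

section Multihomogeneous

variable {ι : Type} {n : ι → ℕ} {F G : MvPolynomial (Σ a, Fin (n a + 1)) ℂ} {d e : ι → ℕ}

theorem isMultiHomogeneous_zero (d : ι → ℕ) :
    IsMultiHomogeneous (0 : MvPolynomial (Σ a, Fin (n a + 1)) ℂ) d := by
  intro s hs
  simp at hs

theorem isMultiHomogeneous_one :
    IsMultiHomogeneous (1 : MvPolynomial (Σ a, Fin (n a + 1)) ℂ) 0 := by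
  intro s hs a
  rw [MvPolynomial.support_one, Finset.mem_singleton] at hs
  simp [hs]

theorem exists_isMultiHomogeneous_X (a : ι) :
    ∃ d, ∀ k, IsMultiHomogeneous (n := n) (MvPolynomial.X ⟨a, k⟩) d := by
  classical
  refine ⟨Pi.single a 1, fun k s hs a' => ?_⟩
  rw [MvPolynomial.support_X, Finset.mem_singleton] at hs
  subst hs
  by_cases h : a' = a
  · subst h
    simp [Finsupp.single_apply]
  · simp [h]

theorem IsMultiHomogeneous.add (hF : IsMultiHomogeneous F d) (hG : IsMultiHomogeneous G d) :
    IsMultiHomogeneous (F + G) d := by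
  classical
  intro s hs
  rcases Finset.mem_union.1 (MvPolynomial.support_add hs) with h | h
  exacts [hF s h, hG s h]

theorem IsMultiHomogeneous.sub (hF : IsMultiHomogeneous F d) (hG : IsMultiHomogeneous G d) :
    IsMultiHomogeneous (F - G) d := by
  classical
  intro s hs
  rcases Finset.mem_union.1 (MvPolynomial.support_sub _ _ _ hs) with h | h
  exacts [hF s h, hG s h]

theorem IsMultiHomogeneous.mul (hF : IsMultiHomogeneous F d) (hG : IsMultiHomogeneous G e) :
    IsMultiHomogeneous (F * G) (d + e) := by
  classical
  intro s hs a
  obtain ⟨t, ht, u, hu, rfl⟩ := Finset.mem_add.1 (MvPolynomial.support_mul _ _ hs)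
  simp [Finset.sum_add_distrib, hF t ht a, hG u hu a]

theorem IsMultiHomogeneous.eval_mul [Fintype ι] (hF : IsMultiHomogeneous F d) (c : ι → ℂ)
    (v : ∀ a, Fin (n a + 1) → ℂ) :
    MvPolynomial.eval (fun s => c s.1 * v s.1 s.2) F =
      (∏ a, c a ^ d a) * MvPolynomial.eval (fun s => v s.1 s.2) F := by
  rw [MvPolynomial.eval_eq', MvPolynomial.eval_eq', Finset.mul_sum]
  refine Finset.sum_congr rfl fun s hs => ?_
  have : ∏ x : Σ a, Fin (n a + 1), c x.1 ^ s x = ∏ a, c a ^ d a := by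
    rw [Fintype.prod_sigma]
    refine Finset.prod_congr rfl fun a _ => ?_
    rw [← hF s hs a]
    exact Finset.prod_pow_eq_pow_sum Finset.univ (fun k => s ⟨a, k⟩) (c a)
  simp only [mul_pow, Finset.prod_mul_distrib, this]
  ring

end Multihomogeneous

/-! ### Maps given by polynomials in homogeneous coordinates -/

section PolynomialMaps

variable {ι κ : Type} {n : ι → ℕ} {m : κ → ℕ}

/-- `v` is a system of homogeneous coordinates for the point `x`. -/
def Represents (v : ∀ a, Fin (n a + 1) → ℂ) (x : MultiProj n) : Prop :=
  ∀ a, ∃ h : v a ≠ 0, x a = Projectivization.mk ℂ (v a) h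

theorem represents_coord (x : MultiProj n) : Represents x.coord x :=
  fun a => ⟨(x a).rep_nonzero, (x a).mk_rep.symm⟩

theorem Represents.unique {v : ∀ a, Fin (n a + 1) → ℂ} {x y : MultiProj n}
    (hx : Represents v x) (hy : Represents v y) : x = y :=
  funext fun a => (hx a).2.trans (hy a).2.symm

theorem Represents.of_smul {v w : ∀ a, Fin (n a + 1) → ℂ} {x : MultiProj n}
    (hv : Represents v x) (hw : ∀ a, w a ≠ 0) (h : ∀ a, ∃ c : ℂ, w a = c • v a) :
    Represents w x := by
  intro a
  refine ⟨hw a, (hv a).2.trans ?_⟩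
  obtain ⟨c, hc⟩ := h a
  exact ((Projectivization.mk_eq_mk_iff' _ _ _ (hw a) (hv a).1).2 ⟨c, hc.symm⟩).symm

theorem Represents.exists_mul {v w : ∀ a, Fin (n a + 1) → ℂ} {x : MultiProj n}
    (hv : Represents v x) (hw : Represents w x) :
    ∃ c : ι → ℂ, (∀ a, c a ≠ 0) ∧ w = fun a k => c a * v a k := by
  have h : ∀ a, ∃ c : ℂ, c • v a = w a := fun a =>
    (Projectivization.mk_eq_mk_iff' _ _ _ (hw a).1 (hv a).1).1 ((hw a).2.symm.trans (hv a).2)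
  choose c hc using h
  refine ⟨c, fun a h0 => (hw a).1 ?_, funext fun a => (hc a).symm⟩
  rw [← hc a, h0, zero_smul]

/-- A system of polynomials in the homogeneous coordinates of `∏ₐ ℙ^{n a}`, which are to be the
homogeneous coordinates of a point of `∏_b ℙ^{m b}`. -/
abbrev PolySystem (n : ι → ℕ) (m : κ → ℕ) : Type :=
  ∀ b, Fin (m b + 1) → MvPolynomial (Σ a, Fin (n a + 1)) ℂ

/-- The values of a system of polynomials at a vector of coordinates. -/
noncomputable def evalVec (F : PolySystem n m)
    (v : ∀ a, Fin (n a + 1) → ℂ) : ∀ b, Fin (m b + 1) → ℂ :=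
  fun b k => MvPolynomial.eval (fun s => v s.1 s.2) (F b k)

/-- Every block of the system consists of polynomials of one common multidegree. -/
def IsHomogeneousSystem (F : PolySystem n m) : Prop :=
  ∀ b, ∃ d, ∀ k, IsMultiHomogeneous (F b k) d

/-- By homogeneity, the point defined by a system of polynomials does not depend on the choice
of homogeneous coordinates. -/
theorem Represents.evalVec_congr [Fintype ι]
    {F : PolySystem n m} (hF : IsHomogeneousSystem F)
    {v w : ∀ a, Fin (n a + 1) → ℂ} {x : MultiProj n} {y : MultiProj m}
    (hv : Represents v x) (hw : Represents w x) (hy : Represents (evalVec F v) y) :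
    Represents (evalVec F w) y := by
  obtain ⟨c, hc, rfl⟩ := hv.exists_mul hw
  have key : ∀ b, ∃ t : ℂ, t ≠ 0 ∧ evalVec F (fun a k => c a * v a k) b = t • evalVec F v b := by
    intro b
    obtain ⟨d, hd⟩ := hF b
    exact ⟨∏ a, c a ^ d a, Finset.prod_ne_zero_iff.2 fun a _ => pow_ne_zero _ (hc a),
      funext fun k => (hd k).eval_mul c v⟩
  refine hy.of_smul (fun b => ?_) fun b => ?_
  · obtain ⟨t, ht, h⟩ := key b
    rw [h]
    exact smul_ne_zero ht (hy b).1
  · obtain ⟨t, -, h⟩ := key b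
    exact ⟨t, h⟩

theorem isRegular_of_represents {X : Set (MultiProj n)} {Y : Set (MultiProj m)} {f : X → Y}
    {F : PolySystem n m} (hF : IsHomogeneousSystem F)
    (h : ∀ x : X, Represents (evalVec F x.1.coord) (f x).1) : IsRegular f := by
  intro x b
  obtain ⟨d, hd⟩ := hF b
  exact ⟨Set.univ, isOpen_univ, trivial, F b, d, hd, fun y _ => h y b⟩

/-- `C` is the condition on homogeneous coordinates, invariant under rescaling them, which
cuts out the set `X`. -/
structure IsCone (C : (∀ a, Fin (n a + 1) → ℂ) → Prop) (X : Set (MultiProj n)) : Prop where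
  ne_zero : ∀ {v}, C v → ∀ a, v a ≠ 0
  mem_iff : ∀ x, x ∈ X ↔ C x.coord
  smul : ∀ {v} (c : ι → ℂ), (∀ a, c a ≠ 0) → C v → C fun a k => c a * v a k

theorem IsCone.mem_iff_of_represents {C : (∀ a, Fin (n a + 1) → ℂ) → Prop}
    {X : Set (MultiProj n)} (hC : IsCone C X) {v : ∀ a, Fin (n a + 1) → ℂ} {x : MultiProj n}
    (hv : Represents v x) : x ∈ X ↔ C v := by
  rw [hC.mem_iff]
  constructor <;> intro h
  · obtain ⟨c, hc, rfl⟩ := (represents_coord x).exists_mul hv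
    exact hC.smul c hc h
  · obtain ⟨c, hc, hx⟩ := hv.exists_mul (represents_coord x)
    rw [hx]
    exact hC.smul c hc h

theorem IsCone.prodVar {C : (∀ a, Fin (n a + 1) → ℂ) → Prop} {X : Set (MultiProj n)}
    (hC : IsCone C X) {D : (∀ a, Fin (m a + 1) → ℂ) → Prop} {Y : Set (MultiProj m)}
    (hD : IsCone D Y) :
    IsCone (n := Sum.elim n m)
      (fun v => C (fun a => v (Sum.inl a)) ∧ D (fun b => v (Sum.inr b))) (prodVar X Y) where
  ne_zero h a := by
    cases a with
    | inl a => exact hC.ne_zero h.1 a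
    | inr b => exact hD.ne_zero h.2 b
  mem_iff x := and_congr (hC.mem_iff x.fst) (hD.mem_iff x.snd)
  smul c hc h := ⟨hC.smul (fun a => c (Sum.inl a)) (fun a => hc _) h.1,
    hD.smul (fun a => c (Sum.inr a)) (fun a => hc _) h.2⟩

theorem IsCone.inter {C : (∀ a, Fin (n a + 1) → ℂ) → Prop} {X : Set (MultiProj n)}
    (hC : IsCone C X) (a : ι) (k : Fin (n a + 1)) :
    IsCone (fun v => C v ∧ v a k ≠ 0) (X ∩ {x | x.coord a k ≠ 0}) where
  ne_zero h := hC.ne_zero h.1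
  mem_iff x := and_congr (hC.mem_iff x) Iff.rfl
  smul c hc h := ⟨hC.smul c hc h.1, mul_ne_zero (hc a) h.2⟩

theorem isOpen_coord_ne_zero (a : ι) (k : Fin (n a + 1)) :
    IsOpen {x : MultiProj n | x.coord a k ≠ 0} := by
  obtain ⟨d, hd⟩ := exists_isMultiHomogeneous_X (n := n) a
  refine TopologicalSpace.isOpen_generateFrom_of_mem ⟨MvPolynomial.X ⟨a, k⟩, d, hd k, ?_⟩
  simp [MultiProj.evalAt]

/-- Homogeneous systems of polynomials which are inverse to each other up to scalars on the
cones over `X` and `Y` define an isomorphism of varieties `X ≃ Y`. -/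
theorem exists_regular_equiv [Fintype ι] [Fintype κ]
    {C : (∀ a, Fin (n a + 1) → ℂ) → Prop} {X : Set (MultiProj n)} (hC : IsCone C X)
    {D : (∀ a, Fin (m a + 1) → ℂ) → Prop} {Y : Set (MultiProj m)} (hD : IsCone D Y)
    {F : PolySystem n m} (hF : IsHomogeneousSystem F)
    {G : PolySystem m n} (hG : IsHomogeneousSystem G)
    (hCD : ∀ v, C v → D (evalVec F v)) (hDC : ∀ v, D v → C (evalVec G v))
    (hGF : ∀ v, C v → ∀ a, ∃ c : ℂ, evalVec G (evalVec F v) a = c • v a)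
    (hFG : ∀ v, D v → ∀ b, ∃ c : ℂ, evalVec F (evalVec G v) b = c • v b) :
    ∃ φ : X ≃ Y, IsRegular φ ∧ IsRegular φ.symm ∧
      ∀ x : X, Represents (evalVec F x.1.coord) (φ x).1 := by
  have hf : ∀ x : X, ∃ y : Y, Represents (evalVec F x.1.coord) y.1 := by
    intro x
    have hx := hCD _ ((hC.mem_iff x.1).1 x.2)
    have hy : Represents (evalVec F x.1.coord)
        (fun b => Projectivization.mk ℂ _ (hD.ne_zero hx b)) := fun b => ⟨_, rfl⟩
    exact ⟨⟨_, (hD.mem_iff_of_represents hy).2 hx⟩, hy⟩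
  have hg : ∀ y : Y, ∃ x : X, Represents (evalVec G y.1.coord) x.1 := by
    intro y
    have hy := hDC _ ((hD.mem_iff y.1).1 y.2)
    have hx : Represents (evalVec G y.1.coord)
        (fun a => Projectivization.mk ℂ _ (hC.ne_zero hy a)) := fun b => ⟨_, rfl⟩
    exact ⟨⟨_, (hC.mem_iff_of_represents hx).2 hy⟩, hx⟩
  choose f hf using hf
  choose g hg using hg
  refine ⟨⟨f, g, fun x => Subtype.ext ?_, fun y => Subtype.ext ?_⟩,
    isRegular_of_represents hF hf, isRegular_of_represents hG hg, hf⟩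
  · have hx := (hC.mem_iff x.1).1 x.2
    exact (Represents.evalVec_congr hG (represents_coord _) (hf x) (hg (f x))).unique
      ((represents_coord x.1).of_smul (hC.ne_zero (hDC _ (hCD _ hx))) (hGF _ hx))
  · have hy := (hD.mem_iff y.1).1 y.2
    exact (Represents.evalVec_congr hF (represents_coord _) (hg y) (hf (g y))).unique
      ((represents_coord y.1).of_smul (hD.ne_zero (hCD _ (hDC _ hy))) (hFG _ hy))

end PolynomialMaps

/-! ### Bounded flags in coordinates indexed by natural numbers -/

section Flags

/-- `z k`, for `k ≤ n`, are homogeneous coordinates `(z k 0, …, z k k)` of the lines of a bounded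
flag: the first `k + 1` coordinates of `z (k + 1)` are a multiple of those of `z k`.
The entries `z k r` with `r > k` or `k > n` are irrelevant. -/
structure IsFlag (n : ℕ) (z : ℕ → ℕ → ℂ) : Prop where
  ne_zero : ∀ k ≤ n, ∃ r ≤ k, z k r ≠ 0
  step : ∀ k < n, ∃ c, ∀ r ≤ k, z (k + 1) r = c * z k r

/-- The left-hand side of the equation of `R_{i,j}`. -/
def pairing (i j : ℕ) (z w : ℕ → ℕ → ℂ) : ℂ :=
  ∑ k ∈ Finset.range (min i j + 1), z i (i - k) * w j (j - k)

/-- `(z, w)` are homogeneous coordinates of a point of `R_{i,j}`. -/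
structure IsRayPair (i j : ℕ) (z w : ℕ → ℕ → ℂ) : Prop where
  left : IsFlag i z
  right : IsFlag j w
  pairing_eq_zero : pairing i j z w = 0

/-- Equality of the relevant entries. -/
def EqBelow (n : ℕ) (z z' : ℕ → ℕ → ℂ) : Prop :=
  ∀ k ≤ n, ∀ r ≤ k, z k r = z' k r

/-- Equality of the relevant entries up to non-zero scalars depending on the row. -/
def ScaledBelow (n : ℕ) (z z' : ℕ → ℕ → ℂ) : Prop :=
  ∀ k ≤ n, ∃ c : ℂ, c ≠ 0 ∧ ∀ r ≤ k, z' k r = c * z k r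

theorem EqBelow.scaledBelow {n : ℕ} {z z' : ℕ → ℕ → ℂ} (h : EqBelow n z z') :
    ScaledBelow n z z' :=
  fun k hk => ⟨1, one_ne_zero, fun r hr => by rw [one_mul, h k hk r hr]⟩

theorem IsFlag.of_scaledBelow {n : ℕ} {z z' : ℕ → ℕ → ℂ} (hz : IsFlag n z)
    (h : ScaledBelow n z z') : IsFlag n z' where
  ne_zero k hk := by
    obtain ⟨r, hr, h0⟩ := hz.ne_zero k hk
    obtain ⟨c, hc, h⟩ := h k hk
    exact ⟨r, hr, by rw [h r hr]; exact mul_ne_zero hc h0⟩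
  step k hk := by
    obtain ⟨t, ht⟩ := hz.step k hk
    obtain ⟨c, hc, h1⟩ := h k hk.le
    obtain ⟨e, -, h2⟩ := h (k + 1) hk
    refine ⟨e * t / c, fun r hr => ?_⟩
    rw [h1 r hr, h2 r (by omega), ht r hr]
    field_simp

theorem IsRayPair.of_scaledBelow {i j : ℕ} {z z' w w' : ℕ → ℕ → ℂ} (h : IsRayPair i j z w)
    (hz : ScaledBelow i z z') (hw : ScaledBelow j w w') : IsRayPair i j z' w' where
  left := h.left.of_scaledBelow hz
  right := h.right.of_scaledBelow hw
  pairing_eq_zero := by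
    obtain ⟨c, -, hc⟩ := hz i le_rfl
    obtain ⟨e, -, he⟩ := hw j le_rfl
    have : pairing i j z' w' = c * e * pairing i j z w := by
      rw [pairing, pairing, Finset.mul_sum]
      refine Finset.sum_congr rfl fun k _ => ?_
      rw [hc _ (Nat.sub_le _ _), he _ (Nat.sub_le _ _)]
      ring
    rw [this, h.pairing_eq_zero, mul_zero]

theorem IsRayPair.swap {i j : ℕ} {z w : ℕ → ℕ → ℂ} (h : IsRayPair i j z w) :
    IsRayPair j i w z where
  left := h.right
  right := h.left
  pairing_eq_zero := by
    rw [← h.pairing_eq_zero, pairing, pairing, min_comm]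
    exact Finset.sum_congr rfl fun k _ => mul_comm _ _

theorem IsFlag.restrict {m n : ℕ} {z : ℕ → ℕ → ℂ} (hz : IsFlag n z) (h : m ≤ n) : IsFlag m z where
  ne_zero k hk := hz.ne_zero k (hk.trans h)
  step k hk := hz.step k (hk.trans_le h)

theorem IsFlag.zero_zero_ne_zero {n : ℕ} {z : ℕ → ℕ → ℂ} (hz : IsFlag n z) : z 0 0 ≠ 0 := by
  obtain ⟨r, hr, h⟩ := hz.ne_zero 0 (Nat.zero_le _)
  rwa [show r = 0 by omega] at h

/-- The line `l_k` is contained in `l_m ⊕ ℂ⟨e_{m+1}, …, e_k⟩`. -/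
theorem IsFlag.exists_eq_mul {n : ℕ} {z : ℕ → ℕ → ℂ} (hz : IsFlag n z) {m k : ℕ} (hmk : m ≤ k)
    (hk : k ≤ n) : ∃ c, ∀ r ≤ m, z k r = c * z m r := by
  induction k, hmk using Nat.le_induction with
  | base => exact ⟨1, fun r _ => (one_mul _).symm⟩
  | succ k hmk ih =>
    obtain ⟨c, hc⟩ := ih (by omega)
    obtain ⟨t, ht⟩ := hz.step k hk
    exact ⟨t * c, fun r hr => by rw [ht r (by omega), hc r hr, mul_assoc]⟩

end Flags

/-! ### Splitting off the lower part of a bounded flag -/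

section Split

variable {A B : Type*} [CommRing A] [CommRing B]

/-- The upper part `l_m, l_{m+1}, …` of a bounded flag, as a bounded flag for the basis vectors
`σ, e_{m+1}, e_{m+2}, …`, where `σ` is the generator of `l_m` whose `s`-th coordinate is `1`. The
coefficient of `σ` is then the `s`-th coordinate. -/
def upperFlag (m s : ℕ) (z : ℕ → ℕ → A) (k r : ℕ) : A :=
  if r = 0 then z (m + k) s else z (m + k) (m + r)

/-- The bounded flag with lower part `b` and upper part `z`. It inverts `upperFlag`; the
substitution of `σ = b m / b m s` for the zeroth basis vector is freed of its denominator. The line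
`l_m` comes from the line `l_0` of `z`, whose only coordinate `z 0 0` rescales `b m`. -/
def glueFlag (m s : ℕ) (b z : ℕ → ℕ → A) (k r : ℕ) : A :=
  if k < m then b k r else if r ≤ m then z (k - m) 0 * b m r else b m s * z (k - m) (r - m)

theorem map_upperFlag (f : A →+* B) (m s : ℕ) (z : ℕ → ℕ → A) (k r : ℕ) :
    f (upperFlag m s z k r) = upperFlag m s (fun k r => f (z k r)) k r := by
  simp only [upperFlag, apply_ite f]

theorem map_glueFlag (f : A →+* B) (m s : ℕ) (b z : ℕ → ℕ → A) (k r : ℕ) :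
    f (glueFlag m s b z k r) =
      glueFlag m s (fun k r => f (b k r)) (fun k r => f (z k r)) k r := by
  simp only [glueFlag, apply_ite f, map_mul]

variable {m s n : ℕ}

theorem EqBelow.upperFlag {z z' : ℕ → ℕ → ℂ} (hs : s ≤ m) (h : EqBelow (m + n) z z') :
    EqBelow n (upperFlag m s z) (upperFlag m s z') := by
  intro k hk r hr
  simp only [RayVar.upperFlag]
  rw [h (m + k) (by omega) s (by omega), h (m + k) (by omega) (m + r) (by omega)]

theorem EqBelow.glueFlag {b b' z z' : ℕ → ℕ → ℂ} (hs : s ≤ m) (hb : EqBelow m b b')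
    (h : EqBelow n z z') : EqBelow (m + n) (glueFlag m s b z) (glueFlag m s b' z') := by
  intro k hk r hr
  simp only [RayVar.glueFlag]
  split_ifs with h1 h2
  · exact hb k h1.le r hr
  · rw [h (k - m) (by omega) 0 (by omega), hb m le_rfl r h2]
  · rw [h (k - m) (by omega) (r - m) (by omega), hb m le_rfl s hs]

theorem IsFlag.upperFlag {z : ℕ → ℕ → ℂ} (hz : IsFlag (m + n) z) (hs : s ≤ m) (h0 : z m s ≠ 0) :
    IsFlag n (upperFlag m s z) where
  ne_zero k hk := by
    obtain ⟨r, hr, hr0⟩ := hz.ne_zero (m + k) (by omega)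
    by_cases hrm : r ≤ m
    · obtain ⟨c, hc⟩ := hz.exists_eq_mul (Nat.le_add_right m k) (by omega)
      refine ⟨0, Nat.zero_le _, ?_⟩
      rw [RayVar.upperFlag, if_pos rfl, hc s hs]
      refine mul_ne_zero ?_ h0
      rintro rfl
      exact hr0 (by rw [hc r hrm, zero_mul])
    · refine ⟨r - m, by omega, ?_⟩
      rw [RayVar.upperFlag, if_neg (by omega)]
      rwa [Nat.add_sub_cancel' (by omega)]
  step k hk := by
    obtain ⟨c, hc⟩ := hz.step (m + k) (by omega)
    refine ⟨c, fun r hr => ?_⟩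
    simp only [RayVar.upperFlag]
    split_ifs
    · exact hc s (by omega)
    · exact hc (m + r) (by omega)

theorem IsFlag.glueFlag {b z : ℕ → ℕ → ℂ} (hb : IsFlag m b) (hz : IsFlag n z) (hs : s ≤ m)
    (h0 : b m s ≠ 0) : IsFlag (m + n) (glueFlag m s b z) where
  ne_zero k hk := by
    by_cases hkm : k < m
    · simpa only [RayVar.glueFlag, if_pos hkm] using hb.ne_zero k hkm.le
    · obtain ⟨r, hr, hr0⟩ := hz.ne_zero (k - m) (by omega)
      simp only [RayVar.glueFlag, if_neg hkm]
      rcases Nat.eq_zero_or_pos r with rfl | hpos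
      · exact ⟨s, by omega, by rw [if_pos hs]; exact mul_ne_zero hr0 h0⟩
      · refine ⟨r + m, by omega, ?_⟩
        rw [if_neg (by omega), Nat.add_sub_cancel]
        exact mul_ne_zero h0 hr0
  step k hk := by
    rcases lt_trichotomy (k + 1) m with h | h | h
    · simpa only [RayVar.glueFlag, if_pos h, if_pos (show k < m by omega)] using
        hb.step k (by omega)
    · obtain ⟨c, hc⟩ := hb.step k (by omega)
      refine ⟨z 0 0 * c, fun r hr => ?_⟩
      subst h
      simp only [RayVar.glueFlag, lt_irrefl, if_false, if_pos (Nat.lt_succ_self k),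
        if_pos (show r ≤ k + 1 by omega), Nat.sub_self]
      rw [hc r hr, mul_assoc]
    · obtain ⟨c, hc⟩ := hz.step (k - m) (by omega)
      refine ⟨c, fun r hr => ?_⟩
      simp only [RayVar.glueFlag, if_neg (show ¬ k + 1 < m by omega),
        if_neg (show ¬ k < m by omega)]
      rw [show k + 1 - m = k - m + 1 by omega]
      split_ifs with hrm
      · rw [hc 0 (by omega), mul_assoc]
      · rw [hc (r - m) (by omega)]
        ring

theorem glueFlag_upperFlag {z : ℕ → ℕ → ℂ} (hz : IsFlag (m + n) z) (hs : s ≤ m) {k : ℕ}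
    (hk : k ≤ m + n) :
    ∃ c, ∀ r ≤ k, glueFlag m s z (upperFlag m s z) k r = c * z k r := by
  by_cases hkm : k < m
  · exact ⟨1, fun r _ => by rw [glueFlag, if_pos hkm, one_mul]⟩
  · refine ⟨z m s, fun r hr => ?_⟩
    obtain ⟨c, hc⟩ := hz.exists_eq_mul (not_lt.1 hkm) hk
    rw [glueFlag, if_neg hkm, upperFlag, if_pos rfl, Nat.add_sub_cancel' (not_lt.1 hkm)]
    split_ifs with hrm
    · rw [hc s hs, hc r hrm]
      ring
    · rw [upperFlag, if_neg (by omega), Nat.add_sub_cancel' (not_lt.1 hkm),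
        Nat.add_sub_cancel' (by omega)]

theorem upperFlag_glueFlag (b z : ℕ → ℕ → ℂ) (hs : s ≤ m) (k r : ℕ) :
    upperFlag m s (glueFlag m s b z) k r = b m s * z k r := by
  simp only [upperFlag, glueFlag, if_neg (show ¬ m + k < m by omega), if_pos hs,
    Nat.add_sub_cancel_left]
  split_ifs with h1 h2
  · rw [h1, mul_comm]
  · omega
  · rfl

/-- The lower part of the glued flag is `b`. -/
theorem glueFlag_lower (b z : ℕ → ℕ → ℂ) {k : ℕ} (hk : k ≤ m) :
    ∃ c, ∀ r ≤ k, glueFlag m s b z k r = c * b k r := by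
  rcases hk.lt_or_eq with h | rfl
  · exact ⟨1, fun r _ => by rw [glueFlag, if_pos h, one_mul]⟩
  · exact ⟨z 0 0, fun r hr => by rw [glueFlag, if_neg (lt_irrefl _), if_pos hr, Nat.sub_self]⟩

/-- The equation of `R_{i,j}`, for `i > j`, does not involve the coordinates of the lower part. -/
theorem pairing_upperFlag (m s j : ℕ) (z w : ℕ → ℕ → ℂ) :
    pairing (j + 1) j (upperFlag m s z) w = pairing (m + (j + 1)) j z w := by
  rw [pairing, pairing, min_eq_right (by omega), min_eq_right (by omega)]
  refine Finset.sum_congr rfl fun k hk => ?_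
  have := Finset.mem_range.1 hk
  rw [upperFlag, if_neg (by omega), show m + (j + 1 - k) = m + (j + 1) - k by omega]

theorem IsRayPair.upperFlag {j : ℕ} {z w : ℕ → ℕ → ℂ} (h : IsRayPair (m + (j + 1)) j z w)
    (hs : s ≤ m) (h0 : z m s ≠ 0) : IsRayPair (j + 1) j (upperFlag m s z) w :=
  ⟨h.left.upperFlag hs h0, h.right, (pairing_upperFlag m s j z w).trans h.pairing_eq_zero⟩

theorem IsRayPair.glueFlag {j : ℕ} {b z w : ℕ → ℕ → ℂ} (hb : IsFlag m b)
    (h : IsRayPair (j + 1) j z w) (hs : s ≤ m) (h0 : b m s ≠ 0) :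
    IsRayPair (m + (j + 1)) j (glueFlag m s b z) w := by
  refine ⟨hb.glueFlag h.left hs h0, h.right, ?_⟩
  have := (h.of_scaledBelow (z' := RayVar.upperFlag m s (RayVar.glueFlag m s b z)) (w' := w)
    (fun k _ => ⟨b m s, h0, fun r _ => upperFlag_glueFlag b z hs k r⟩)
    (EqBelow.scaledBelow fun _ _ _ _ => rfl)).pairing_eq_zero
  rwa [pairing_upperFlag] at this

end Split

/-! ### Changing the basis of the plane spanned by `e_0` and `e_1` -/

section Twist

variable {A B : Type*} [CommRing A] [CommRing B]

/-- The action on bounded flags of the linear map which replaces the coordinates `w_0, w_1` by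
`w_{1-s}` and `σ_0 w_0 + σ_1 w_1`, where `σ = b / b s`, freed of its denominator. The line `l_0`
stays the same. -/
def twist (s : ℕ) (b : ℕ → A) (w : ℕ → ℕ → A) (k r : ℕ) : A :=
  if k = 0 then 1
  else if r = 0 then b s * w k (1 - s)
  else if r = 1 then b 0 * w k 0 + b 1 * w k 1
  else b s * w k r

/-- The inverse of `twist`, up to scalars: the coordinates `w_0, w_1` are recovered from
`w_{1-s} = w'_0` and `w_s = w'_1 - σ_{1-s} w'_0`, multiplied by `b s`. -/
def untwist (s : ℕ) (b : ℕ → A) (w : ℕ → ℕ → A) (k r : ℕ) : A :=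
  if k = 0 then 1
  else if r = s then b s * w k 1 - b (1 - s) * w k 0
  else if r = 1 - s then b s * w k 0
  else b s * w k r

theorem map_twist (f : A →+* B) (s : ℕ) (b : ℕ → A) (w : ℕ → ℕ → A) (k r : ℕ) :
    f (twist s b w k r) = twist s (fun r => f (b r)) (fun k r => f (w k r)) k r := by
  simp only [twist, apply_ite f, map_mul, map_add, map_one]

theorem map_untwist (f : A →+* B) (s : ℕ) (b : ℕ → A) (w : ℕ → ℕ → A) (k r : ℕ) :
    f (untwist s b w k r) = untwist s (fun r => f (b r)) (fun k r => f (w k r)) k r := by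
  simp only [untwist, apply_ite f, map_mul, map_sub, map_one]

variable {s n : ℕ}

theorem EqBelow.twist {b b' : ℕ → ℂ} {w w' : ℕ → ℕ → ℂ} (hs : s ≤ 1)
    (hb : ∀ r ≤ 1, b r = b' r) (h : EqBelow n w w') :
    EqBelow n (twist s b w) (twist s b' w') := by
  intro k hk r hr
  simp only [RayVar.twist]
  split_ifs with h1
  · rfl
  · rw [hb s hs, h k hk (1 - s) (by omega)]
  · rw [hb 0 (by omega), hb 1 le_rfl, h k hk 0 (by omega), h k hk 1 (by omega)]
  · rw [hb s hs, h k hk r hr]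

theorem EqBelow.untwist {b b' : ℕ → ℂ} {w w' : ℕ → ℕ → ℂ} (hs : s ≤ 1)
    (hb : ∀ r ≤ 1, b r = b' r) (h : EqBelow n w w') :
    EqBelow n (untwist s b w) (untwist s b' w') := by
  intro k hk r hr
  simp only [RayVar.untwist]
  split_ifs with h1
  · rfl
  · rw [hb s hs, hb (1 - s) (by omega), h k hk 0 (by omega), h k hk 1 (by omega)]
  · rw [hb s hs, h k hk 0 (by omega)]
  · rw [hb s hs, h k hk r hr]

theorem untwist_twist_of_ne_zero (hs : s ≤ 1) (b : ℕ → ℂ) (w : ℕ → ℕ → ℂ) {k : ℕ} (hk : k ≠ 0)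
    (r : ℕ) : untwist s b (twist s b w) k r = b s ^ 2 * w k r := by
  simp only [twist, untwist, if_neg hk, one_ne_zero, if_true, if_false]
  interval_cases s <;> split_ifs <;> first | omega | (subst_vars; ring)

theorem twist_untwist_of_ne_zero (hs : s ≤ 1) (b : ℕ → ℂ) (w : ℕ → ℕ → ℂ) {k : ℕ} (hk : k ≠ 0)
    (r : ℕ) : twist s b (untwist s b w) k r = b s ^ 2 * w k r := by
  simp only [twist, untwist, if_neg hk]
  interval_cases s <;> simp <;> split_ifs <;> first | omega | (subst_vars; ring)

theorem IsFlag.twist {b : ℕ → ℂ} {w : ℕ → ℕ → ℂ} (hw : IsFlag n w) (hs : s ≤ 1) (h0 : b s ≠ 0) :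
    IsFlag n (twist s b w) where
  ne_zero k hk := by
    rcases Nat.eq_zero_or_pos k with rfl | hk0
    · exact ⟨0, le_rfl, by simp [RayVar.twist]⟩
    · -- a linear map with a left inverse does not kill a non-zero vector
      by_contra! hall
      obtain ⟨r, hr, hr0⟩ := hw.ne_zero k hk
      have h := untwist_twist_of_ne_zero hs b w hk0.ne' r
      simp only [RayVar.untwist, hall 0 (by omega), hall 1 (by omega), hall r hr, if_neg hk0.ne',
        mul_zero, sub_zero, ite_self] at h
      exact mul_ne_zero (pow_ne_zero 2 h0) hr0 h.symm
  step k hk := by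
    rcases Nat.eq_zero_or_pos k with rfl | hk0
    · refine ⟨RayVar.twist s b w 1 0, fun r hr => ?_⟩
      obtain rfl : r = 0 := by omega
      simp [RayVar.twist]
    · obtain ⟨c, hc⟩ := hw.step k hk
      refine ⟨c, fun r hr => ?_⟩
      simp only [RayVar.twist, if_neg hk0.ne', if_neg k.succ_ne_zero]
      rw [hc (1 - s) (by omega), hc 0 (by omega), hc 1 (by omega), hc r hr]
      split_ifs <;> ring

theorem IsFlag.untwist {b : ℕ → ℂ} {w : ℕ → ℕ → ℂ} (hw : IsFlag n w) (hs : s ≤ 1)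
    (h0 : b s ≠ 0) : IsFlag n (untwist s b w) where
  ne_zero k hk := by
    rcases Nat.eq_zero_or_pos k with rfl | hk0
    · exact ⟨0, le_rfl, by simp [RayVar.untwist]⟩
    · -- a linear map with a left inverse does not kill a non-zero vector
      by_contra! hall
      obtain ⟨r, hr, hr0⟩ := hw.ne_zero k hk
      have h := twist_untwist_of_ne_zero hs b w hk0.ne' r
      simp only [RayVar.twist, hall 0 (by omega), hall 1 (by omega), hall r hr, if_neg hk0.ne',
        hall (1 - s) (by omega), mul_zero, add_zero, ite_self] at h
      exact mul_ne_zero (pow_ne_zero 2 h0) hr0 h.symm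
  step k hk := by
    rcases Nat.eq_zero_or_pos k with rfl | hk0
    · refine ⟨RayVar.untwist s b w 1 0, fun r hr => ?_⟩
      obtain rfl : r = 0 := by omega
      simp [RayVar.untwist]
    · obtain ⟨c, hc⟩ := hw.step k hk
      refine ⟨c, fun r hr => ?_⟩
      simp only [RayVar.untwist, if_neg hk0.ne', if_neg k.succ_ne_zero]
      rw [hc 0 (by omega), hc 1 (by omega), hc r hr]
      split_ifs <;> ring

theorem untwist_twist {w : ℕ → ℕ → ℂ} (hw : IsFlag n w) (hs : s ≤ 1) (b : ℕ → ℂ) (k : ℕ) :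
    ∃ c, ∀ r ≤ k, untwist s b (twist s b w) k r = c * w k r := by
  rcases Nat.eq_zero_or_pos k with rfl | hk0
  · refine ⟨(w 0 0)⁻¹, fun r hr => ?_⟩
    obtain rfl : r = 0 := by omega
    simp [untwist, hw.zero_zero_ne_zero]
  · exact ⟨b s ^ 2, fun r _ => untwist_twist_of_ne_zero hs b w hk0.ne' r⟩

/-- `twist` inverts `untwist` up to scalars, even if the vectors `b` they use are rescaled. -/
theorem scaledBelow_twist_untwist {b b' : ℕ → ℂ} {w : ℕ → ℕ → ℂ} {c : ℂ} (hc : c ≠ 0)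
    (hb : ∀ r ≤ 1, b' r = c * b r) (hw : IsFlag n w) (hs : s ≤ 1) (h0 : b s ≠ 0) :
    ScaledBelow n w (twist s b' (untwist s b w)) := by
  intro k _
  rcases Nat.eq_zero_or_pos k with rfl | hk0
  · have hw0 := hw.zero_zero_ne_zero
    refine ⟨(w 0 0)⁻¹, inv_ne_zero hw0, fun t ht => ?_⟩
    obtain rfl : t = 0 := by omega
    simp [twist, hw0]
  · refine ⟨c * b s ^ 2, mul_ne_zero hc (pow_ne_zero 2 h0), fun r _ => ?_⟩
    rw [mul_assoc, ← twist_untwist_of_ne_zero hs b w hk0.ne']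
    simp only [twist, if_neg hk0.ne', hb s hs, hb 0 zero_le_one, hb 1 le_rfl]
    split_ifs <;> ring

/-- The bounded flag `l_0 = ℂ e_0`, `l_1 = ℂ b`. -/
def lineFlag (b : ℕ → A) (k r : ℕ) : A := if k = 0 then 1 else b r

theorem map_lineFlag (f : A →+* B) (b : ℕ → A) (k r : ℕ) :
    f (lineFlag b k r) = lineFlag (fun r => f (b r)) k r := by
  simp only [lineFlag, apply_ite f, map_one]

theorem isFlag_lineFlag {b : ℕ → ℂ} (hs : s ≤ 1) (h0 : b s ≠ 0) : IsFlag 1 (lineFlag b) where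
  ne_zero k hk := by
    rcases Nat.eq_zero_or_pos k with rfl | hk0
    · exact ⟨0, le_rfl, by simp [lineFlag]⟩
    · exact ⟨s, by omega, by rwa [lineFlag, if_neg hk0.ne']⟩
  step k hk := by
    obtain rfl : k = 0 := by omega
    refine ⟨b 0, fun r hr => ?_⟩
    obtain rfl : r = 0 := by omega
    simp [lineFlag]

theorem pairing_self (n : ℕ) (z w : ℕ → ℕ → ℂ) :
    pairing n n z w = ∑ r ∈ Finset.range (n + 1), z n r * w n r := by
  rw [pairing, min_self, ← Finset.sum_range_reflect]
  refine Finset.sum_congr rfl fun k hk => ?_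
  have := Finset.mem_range.1 hk
  rw [show n - (n + 1 - 1 - k) = k by omega]

theorem pairing_succ (n : ℕ) (z w : ℕ → ℕ → ℂ) :
    pairing n (n + 1) z w = ∑ r ∈ Finset.range (n + 1), z n r * w (n + 1) (r + 1) := by
  rw [pairing, min_eq_left (by omega), ← Finset.sum_range_reflect]
  refine Finset.sum_congr rfl fun k hk => ?_
  have := Finset.mem_range.1 hk
  rw [show n - (n + 1 - 1 - k) = k by omega, show n + 1 - (n + 1 - 1 - k) = k + 1 by omega]

/-- If `z_{n+1} = t σ + ∑_{r ≥ 2} z_{n+1,r} e_r` with `σ` the generator of `l_1`, then the pairing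
of `z_{n+1}` with `w` is `t (σ_0 w_0 + σ_1 w_1) + ∑_{r ≥ 2} z_{n+1,r} w_r`. -/
theorem pairing_upperFlag_twist {z : ℕ → ℕ → ℂ} (hz : IsFlag (n + 1) z) (hs : s ≤ 1)
    (w : ℕ → ℕ → ℂ) :
    pairing n (n + 1) (upperFlag 1 s z) (twist s (z 1) w) =
      z 1 s * pairing (n + 1) (n + 1) z w := by
  obtain ⟨c, hc⟩ := hz.exists_eq_mul (m := 1) (k := n + 1) (by omega) le_rfl
  -- the term of index `0` on the left corresponds to those of index `0` and `1` on the right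
  rw [pairing_succ, pairing_self, Finset.sum_range_succ', Finset.sum_range_succ' _ (n + 1),
    Finset.sum_range_succ' _ n, add_assoc, mul_add, Finset.mul_sum]
  congr 1
  · refine Finset.sum_congr rfl fun r _ => ?_
    simp only [upperFlag, twist, add_comm 1]
    simp
    ring
  · simp only [upperFlag, twist, add_comm 1]
    simp
    rw [hc s hs, hc 0 (by omega), hc 1 le_rfl]
    ring

theorem IsRayPair.upperFlag_twist {z w : ℕ → ℕ → ℂ} (h : IsRayPair (n + 1) (n + 1) z w)
    (hs : s ≤ 1) (h0 : z 1 s ≠ 0) :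
    IsRayPair n (n + 1) (RayVar.upperFlag 1 s z) (RayVar.twist s (z 1) w) where
  left := IsFlag.upperFlag (by rw [add_comm]; exact h.left) hs h0
  right := h.right.twist hs h0
  pairing_eq_zero := by
    rw [pairing_upperFlag_twist h.left hs, h.pairing_eq_zero, mul_zero]

theorem glueFlag_lineFlag_one (b : ℕ → ℂ) (z : ℕ → ℕ → ℂ) {r : ℕ} (hr : r ≤ 1) :
    glueFlag 1 s (lineFlag b) z 1 r = z 0 0 * b r := by
  simp [glueFlag, lineFlag, hr]

theorem glueFlag_lineFlag_upperFlag {z y : ℕ → ℕ → ℂ} {b : ℕ → ℂ} (hz : IsFlag (n + 1) z)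
    (hs : s ≤ 1) (hb : ∀ r ≤ 1, b r = z 1 r) (hy : EqBelow n y (upperFlag 1 s z)) {k : ℕ}
    (hk : k ≤ n + 1) : ∃ c, ∀ r ≤ k, glueFlag 1 s (lineFlag b) y k r = c * z k r := by
  rcases Nat.eq_zero_or_pos k with rfl | hk0
  · refine ⟨(z 0 0)⁻¹, fun r hr => ?_⟩
    obtain rfl : r = 0 := by omega
    simp [glueFlag, lineFlag, hz.zero_zero_ne_zero]
  · rw [add_comm] at hz
    obtain ⟨c, hc⟩ := glueFlag_upperFlag hz hs (show k ≤ 1 + n by omega)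
    refine ⟨c, fun r hr => ?_⟩
    rw [← hc r hr]
    simp only [glueFlag, if_neg (show ¬ k < 1 by omega), lineFlag, one_ne_zero, if_false]
    split_ifs with h1
    · rw [hb r h1, hy (k - 1) (by omega) 0 (by omega)]
    · rw [hb s hs, hy (k - 1) (by omega) (r - 1) (by omega)]

theorem IsRayPair.glueFlag_untwist {b : ℕ → ℂ} {z w : ℕ → ℕ → ℂ} (h : IsRayPair n (n + 1) z w)
    (hs : s ≤ 1) (h0 : b s ≠ 0) :
    IsRayPair (n + 1) (n + 1) (RayVar.glueFlag 1 s (lineFlag b) z) (RayVar.untwist s b w) := by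
  have hz : IsFlag (n + 1) (RayVar.glueFlag 1 s (lineFlag b) z) := by
    rw [add_comm]
    exact (isFlag_lineFlag hs h0).glueFlag h.left hs h0
  refine ⟨hz, h.right.untwist hs h0, ?_⟩
  have hz0 := h.left.zero_zero_ne_zero
  have hz1 : ∀ r ≤ 1, RayVar.glueFlag 1 s (lineFlag b) z 1 r = z 0 0 * b r :=
    fun r hr => glueFlag_lineFlag_one b z hr
  have hu : ScaledBelow n z (RayVar.upperFlag 1 s (RayVar.glueFlag 1 s (lineFlag b) z)) :=
    fun k _ => ⟨b s, h0, fun r _ => upperFlag_glueFlag (lineFlag b) z hs k r⟩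
  have ht := scaledBelow_twist_untwist hz0 hz1 h.right hs h0
  have key := pairing_upperFlag_twist hz hs (RayVar.untwist s b w)
  rw [(h.of_scaledBelow hu ht).pairing_eq_zero, hz1 s hs] at key
  exact (mul_eq_zero.1 key.symm).resolve_left (mul_ne_zero hz0 h0)

end Twist

/-! ### Criterion for fibre bundles -/

section Criterion

variable {ι κ τ : Type} {n : ι → ℕ} {m : κ → ℕ} {q : τ → ℕ} {A : Type*}

/-- Concatenation of two families of vectors. -/
def sumVec (u : ∀ a, Fin (n a + 1) → A) (w : ∀ b, Fin (m b + 1) → A) :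
    ∀ c, Fin (Sum.elim n m c + 1) → A
  | Sum.inl a => u a
  | Sum.inr b => w b

theorem evalVec_sumVec (P : PolySystem n m)
    (Q : PolySystem n q)
    (v : ∀ a, Fin (n a + 1) → ℂ) :
    evalVec (sumVec P Q) v = sumVec (evalVec P v) (evalVec Q v) := by
  funext c
  cases c <;> rfl

theorem IsHomogeneousSystem.sumVec
    {P : PolySystem n m}
    {Q : PolySystem n q}
    (hP : IsHomogeneousSystem P) (hQ : IsHomogeneousSystem Q) :
    IsHomogeneousSystem (sumVec P Q)
  | Sum.inl a => hP a
  | Sum.inr b => hQ b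

/-- A projection `p : E → B`, given by the polynomials `P`, is a fibre bundle with fibre `F` if
over each chart `x_{a,k} ≠ 0` of `B` there are homogeneous systems of polynomials `Q`, from
coordinates on `E` to coordinates on `F`, and `G`, from coordinates on `B × F` to coordinates on
`E`, such that `(P, Q)` and `G` are inverse to each other up to scalars. -/
theorem isAlgFibreBundle_of_systems [Fintype ι] [Fintype κ] [Fintype τ]
    {E : Set (MultiProj n)} {B : Set (MultiProj m)} {F : Set (MultiProj q)} {p : E → B}
    {CE : (∀ a, Fin (n a + 1) → ℂ) → Prop} (hE : IsCone CE E)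
    {CB : (∀ a, Fin (m a + 1) → ℂ) → Prop} (hB : IsCone CB B)
    {CF : (∀ a, Fin (q a + 1) → ℂ) → Prop} (hF : IsCone CF F)
    {P : PolySystem n m} (hP : IsHomogeneousSystem P)
    (hp : ∀ x : E, evalVec P x.1.coord = (p x).1.coord)
    (hPB : ∀ v, CE v → CB (evalVec P v))
    (hchart : ∀ b ∈ B, ∃ a k, b.coord a k ≠ 0 ∧
      ∃ (Q : PolySystem n q)
        (G : PolySystem (Sum.elim m q) n),
        IsHomogeneousSystem Q ∧ IsHomogeneousSystem G ∧
        (∀ v, CE v → evalVec P v a k ≠ 0 → CF (evalVec Q v) ∧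
          ∀ a, ∃ c : ℂ, evalVec G (sumVec (evalVec P v) (evalVec Q v)) a = c • v a) ∧
        ∀ u w, CB u → u a k ≠ 0 → CF w → CE (evalVec G (sumVec u w)) ∧
          (∀ b, ∃ c : ℂ, evalVec P (evalVec G (sumVec u w)) b = c • u b) ∧
          ∀ b, ∃ c : ℂ, evalVec Q (evalVec G (sumVec u w)) b = c • w b) :
    IsAlgFibreBundle p F := by
  have hrep : ∀ x : E, Represents (evalVec P x.1.coord) (p x).1 := fun x => by
    rw [hp x]
    exact represents_coord _
  refine ⟨isRegular_of_represents hP hrep, fun b => ?_⟩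
  obtain ⟨a, k, hb, Q, G, hQ, hG, h1, h2⟩ := hchart b.1 b.2
  refine ⟨{x | x.coord a k ≠ 0}, isOpen_coord_ne_zero a k, hb, ?_⟩
  have hE' : IsCone (fun v => CE v ∧ evalVec P v a k ≠ 0)
      (preimageVar p {x | x.coord a k ≠ 0}) :=
    { ne_zero := fun h => hE.ne_zero h.1
      mem_iff := fun x => by
        constructor
        · rintro ⟨hx, h⟩
          refine ⟨(hE.mem_iff x).1 hx, ?_⟩
          rw [hp ⟨x, hx⟩]
          exact h
        · rintro ⟨hx, h⟩
          refine ⟨(hE.mem_iff x).2 hx, ?_⟩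
          rwa [hp ⟨x, (hE.mem_iff x).2 hx⟩] at h
      smul := fun {v} c hc h => by
        refine ⟨hE.smul c hc h.1, ?_⟩
        obtain ⟨d, hd⟩ := hP a
        exact ((hd k).eval_mul c v).trans_ne
          (mul_ne_zero (Finset.prod_ne_zero_iff.2 fun a _ => pow_ne_zero _ (hc a)) h.2) }
  have hsum : ∀ v : ∀ c, Fin (Sum.elim m q c + 1) → ℂ,
      ∃ (u : ∀ a, Fin (m a + 1) → ℂ) (w : ∀ b, Fin (q b + 1) → ℂ), v = sumVec u w := fun v =>
    ⟨fun a => v (Sum.inl a), fun b => v (Sum.inr b), funext fun c => by cases c <;> rfl⟩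
  obtain ⟨φ, hφ, hφ', h⟩ := exists_regular_equiv hE' ((hB.inter a k).prodVar hF)
    (hP.sumVec hQ) hG
    (fun v hv => by
      rw [evalVec_sumVec]
      exact ⟨⟨hPB v hv.1, hv.2⟩, (h1 v hv.1 hv.2).1⟩)
    (fun v hv => by
      obtain ⟨u, w, rfl⟩ := hsum v
      change (CB u ∧ u a k ≠ 0) ∧ CF w at hv
      obtain ⟨hCE, hP', -⟩ := h2 u w hv.1.1 hv.1.2 hv.2
      refine ⟨hCE, ?_⟩
      -- `P (G (u, w))` is a multiple of `u`, and it is non-zero since it lies in the cone of `B`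
      obtain ⟨c, hc⟩ := hP' a
      have h0 := hB.ne_zero (hPB _ hCE) a
      rw [hc] at h0 ⊢
      exact mul_ne_zero (left_ne_zero_of_smul h0) hv.1.2)
    (fun v hv => by
      rw [evalVec_sumVec]
      exact (h1 v hv.1 hv.2).2)
    (fun v hv => by
      obtain ⟨u, w, rfl⟩ := hsum v
      change (CB u ∧ u a k ≠ 0) ∧ CF w at hv
      obtain ⟨-, hP', hQ'⟩ := h2 u w hv.1.1 hv.1.2 hv.2
      rw [evalVec_sumVec]
      rintro (b | b)
      exacts [hP' b, hQ' b])
  refine ⟨φ, hφ, hφ', fun x => ?_⟩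
  have hx : Represents (evalVec P x.1.coord) (φ x).1.fst := fun b => h x (Sum.inl b)
  exact hx.unique (hrep ⟨x.1, x.2.1⟩)

end Criterion

/-! ### Homogeneous coordinates on the varieties -/

section Coordinates

variable {A B : Type*} [CommRing A] [CommRing B] {n : ℕ}

/-- A vector as a function on the natural numbers, extended by zero. -/
def extendRow (v : Fin (n + 1) → A) (r : ℕ) : A := if h : r < n + 1 then v ⟨r, h⟩ else 0

/-- Coordinates of a point of `∏ ℙ^k`, indexed by natural numbers and extended by zero. -/
def extend (v : ∀ k : Fin (n + 1), Fin ((k : ℕ) + 1) → A) (k r : ℕ) : A :=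
  if h : k < n + 1 then extendRow (v ⟨k, h⟩) r else 0

/-- The vectors of relevant entries of `z`. -/
def truncate (z : ℕ → ℕ → A) : ∀ k : Fin (n + 1), Fin ((k : ℕ) + 1) → A := fun k r => z k r

theorem extendRow_val (v : Fin (n + 1) → A) (r : Fin (n + 1)) : extendRow v r = v r := by
  rw [extendRow, dif_pos r.2]

theorem extend_val (v : ∀ k : Fin (n + 1), Fin ((k : ℕ) + 1) → A) (k : Fin (n + 1))
    (r : Fin ((k : ℕ) + 1)) : extend v k r = v k r := by
  rw [extend, dif_pos k.2, extendRow, dif_pos r.2]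

theorem extend_truncate (z : ℕ → ℕ → ℂ) : EqBelow n (extend (n := n) (truncate z)) z := by
  intro k hk r hr
  exact extend_val (truncate z) ⟨k, Nat.lt_succ_of_le hk⟩ ⟨r, Nat.lt_succ_of_le hr⟩

theorem scaledBelow_extend_truncate (n : ℕ) (z : ℕ → ℕ → ℂ) :
    ScaledBelow n z (extend (n := n) (truncate z)) :=
  EqBelow.scaledBelow fun k hk r hr => (extend_truncate z k hk r hr).symm

theorem EqBelow.exists_mul {n : ℕ} {z z' y : ℕ → ℕ → ℂ} (h : EqBelow n z z') {k : ℕ} (hk : k ≤ n)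
    (h' : ∃ c, ∀ r ≤ k, z' k r = c * y k r) : ∃ c, ∀ r ≤ k, z k r = c * y k r := by
  obtain ⟨c, hc⟩ := h'
  exact ⟨c, fun r hr => (h k hk r hr).trans (hc r hr)⟩

theorem map_extendRow (f : A →+* B) (v : Fin (n + 1) → A) (r : ℕ) :
    f (extendRow v r) = extendRow (fun r => f (v r)) r := by
  unfold extendRow
  split_ifs <;> simp

theorem map_extend (f : A →+* B) (v : ∀ k : Fin (n + 1), Fin ((k : ℕ) + 1) → A) (k r : ℕ) :
    f (extend v k r) = extend (fun k r => f (v k r)) k r := by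
  unfold extend
  split_ifs
  · exact map_extendRow f _ r
  · simp

theorem scaledBelow_extend (c : Fin (n + 1) → ℂ) (hc : ∀ k, c k ≠ 0)
    (v : ∀ k : Fin (n + 1), Fin ((k : ℕ) + 1) → ℂ) :
    ScaledBelow n (extend v) (extend fun k r => c k * v k r) := by
  intro k hk
  refine ⟨c ⟨k, Nat.lt_succ_of_le hk⟩, hc _, fun r hr => ?_⟩
  simp [extend, extendRow, Nat.lt_succ_of_le hk, Nat.lt_succ_of_le hr]

theorem exists_truncate_eq_smul {v : ∀ k : Fin (n + 1), Fin ((k : ℕ) + 1) → ℂ} {z : ℕ → ℕ → ℂ}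
    {k : Fin (n + 1)} (h : ∃ c, ∀ r ≤ (k : ℕ), z k r = c * extend v k r) :
    ∃ c : ℂ, truncate z k = c • v k := by
  obtain ⟨c, hc⟩ := h
  refine ⟨c, funext fun r => (hc r (Nat.le_of_lt_succ r.2)).trans ?_⟩
  rw [extend_val]
  rfl

theorem IsFlag.extend_ne_zero {v : ∀ k : Fin (n + 1), Fin ((k : ℕ) + 1) → ℂ}
    (hv : IsFlag n (extend v)) (k : Fin (n + 1)) : v k ≠ 0 := by
  obtain ⟨r, hr, h⟩ := hv.ne_zero k (Nat.le_of_lt_succ k.2)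
  intro h0
  apply h
  have := extend_val v k ⟨r, Nat.lt_succ_of_le hr⟩
  rw [h0] at this
  exact this

theorem isCone_BF (n : ℕ) : IsCone (fun v => IsFlag n (extend v)) (BF n) where
  ne_zero := IsFlag.extend_ne_zero
  smul c hc h := h.of_scaledBelow (scaledBelow_extend c hc _)
  mem_iff x := by
    have hne : ∀ k : Fin (n + 1), ∃ r : Fin (k + 1), x.coord k r ≠ 0 := fun k =>
      Function.ne_iff.1 (x k).rep_nonzero
    constructor
    · intro hx
      refine ⟨fun k hk => ?_, fun k hk => ?_⟩
      · obtain ⟨r, hr⟩ := hne ⟨k, Nat.lt_succ_of_le hk⟩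
        refine ⟨r, Nat.le_of_lt_succ r.2, ?_⟩
        rwa [← extend_val x.coord ⟨k, Nat.lt_succ_of_le hk⟩ r] at hr
      · obtain ⟨s, hs⟩ := hne (Fin.castSucc ⟨k, hk⟩)
        refine ⟨x.coord (Fin.succ ⟨k, hk⟩) s.castSucc / x.coord (Fin.castSucc ⟨k, hk⟩) s,
          fun r hr => ?_⟩
        have h := hx ⟨k, hk⟩ ⟨r, Nat.lt_succ_of_le hr⟩ s
        have h1 := extend_val x.coord (Fin.succ ⟨k, hk⟩)
          (Fin.castSucc ⟨r, Nat.lt_succ_of_le hr⟩)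
        have h2 := extend_val x.coord (Fin.castSucc ⟨k, hk⟩) ⟨r, Nat.lt_succ_of_le hr⟩
        rw [← h1, ← h2] at h
        rw [div_mul_eq_mul_div, eq_div_iff hs]
        exact h
    · intro hx k r s
      obtain ⟨c, hc⟩ := hx.step k k.2
      have h1 : ∀ t : Fin (k + 1), x.coord k.succ t.castSucc = c * x.coord k.castSucc t := by
        intro t
        have h := hc t (Nat.le_of_lt_succ t.2)
        rwa [← extend_val x.coord k.succ t.castSucc, ← extend_val x.coord k.castSucc t]
      rw [h1, h1]
      ring

theorem isCone_R (i j : ℕ) :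
    IsCone (fun v => IsRayPair i j (extend fun k => v (Sum.inl k)) (extend fun k => v (Sum.inr k)))
      (R i j) where
  ne_zero h a := by
    cases a with
    | inl k => exact h.left.extend_ne_zero k
    | inr k => exact h.right.extend_ne_zero k
  smul c hc h := h.of_scaledBelow (scaledBelow_extend (fun k => c (Sum.inl k)) (fun _ => hc _) _)
    (scaledBelow_extend (fun k => c (Sum.inr k)) (fun _ => hc _) _)
  mem_iff x := by
    have hsum : ∑ k : Fin (min i j + 1),
        x.fst.coord (Fin.last i) ⟨i - k, Nat.lt_succ_of_le (Nat.sub_le i k)⟩ *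
        x.snd.coord (Fin.last j) ⟨j - k, Nat.lt_succ_of_le (Nat.sub_le j k)⟩ =
        pairing i j (extend x.fst.coord) (extend x.snd.coord) := by
      rw [pairing, Finset.sum_range]
      refine Finset.sum_congr rfl fun k _ => ?_
      have h1 := extend_val x.fst.coord (Fin.last i)
        ⟨i - k, Nat.lt_succ_of_le (Nat.sub_le i k)⟩
      have h2 := extend_val x.snd.coord (Fin.last j)
        ⟨j - k, Nat.lt_succ_of_le (Nat.sub_le j k)⟩
      rw [← h1, ← h2]
      rfl
    constructor
    · rintro ⟨h1, h2, h3⟩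
      exact ⟨((isCone_BF i).mem_iff _).1 h1, ((isCone_BF j).mem_iff _).1 h2,
        hsum.symm.trans h3⟩
    · intro h
      exact ⟨((isCone_BF i).mem_iff _).2 h.left, ((isCone_BF j).mem_iff _).2 h.right,
        hsum.trans h.pairing_eq_zero⟩

theorem isCone_P1 : IsCone (fun v => v () ≠ 0) P1 where
  ne_zero h _ := h
  mem_iff x := iff_of_true trivial (x ()).rep_nonzero
  smul _ hc h := smul_ne_zero (hc ()) h

end Coordinates

/-! ### Systems of polynomials -/

section Systems

variable {ι : Type} {n : ι → ℕ}

/-- The homogeneous coordinates as polynomials. -/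
noncomputable def vars (n : ι → ℕ) (a : ι) (k : Fin (n a + 1)) :
    MvPolynomial (Σ a, Fin (n a + 1)) ℂ :=
  MvPolynomial.X ⟨a, k⟩

theorem eval_vars (v : ∀ a, Fin (n a + 1) → ℂ) (a : ι) (k : Fin (n a + 1)) :
    MvPolynomial.eval (fun s => v s.1 s.2) (vars n a k) = v a k :=
  MvPolynomial.eval_X _

/-- The polynomials in each row are multihomogeneous of one multidegree. -/
def IsHomogeneousRows (z : ℕ → ℕ → MvPolynomial (Σ a, Fin (n a + 1)) ℂ) : Prop :=
  ∀ k, ∃ d, ∀ r, IsMultiHomogeneous (z k r) d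

theorem IsHomogeneousRows.truncate {z : ℕ → ℕ → MvPolynomial (Σ a, Fin (n a + 1)) ℂ}
    (hz : IsHomogeneousRows z) (l : ℕ) :
    IsHomogeneousSystem (m := fun k : Fin (l + 1) => (k : ℕ)) (truncate z) := fun k => by
  obtain ⟨d, hd⟩ := hz k
  exact ⟨d, fun r => hd r⟩

theorem exists_isMultiHomogeneous_extendRow {l : ℕ} {a : ι} (f : Fin (l + 1) → Fin (n a + 1)) :
    ∃ d, ∀ r, IsMultiHomogeneous (extendRow (fun k => vars n a (f k)) r) d := by
  obtain ⟨d, hd⟩ := exists_isMultiHomogeneous_X (n := n) a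
  refine ⟨d, fun r => ?_⟩
  unfold extendRow
  split_ifs
  exacts [hd _, isMultiHomogeneous_zero d]

theorem isHomogeneousRows_extend {l : ℕ} (e : Fin (l + 1) → ι)
    (f : ∀ k : Fin (l + 1), Fin ((k : ℕ) + 1) → Fin (n (e k) + 1)) :
    IsHomogeneousRows (extend fun k r => vars n (e k) (f k r)) := by
  intro k
  by_cases h : k < l + 1
  · obtain ⟨d, hd⟩ := exists_isMultiHomogeneous_extendRow (f ⟨k, h⟩)
    exact ⟨d, fun r => by simpa only [extend, dif_pos h] using hd r⟩
  · exact ⟨0, fun r => by simpa only [extend, dif_neg h] using isMultiHomogeneous_zero 0⟩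

theorem IsHomogeneousRows.upperFlag {z : ℕ → ℕ → MvPolynomial (Σ a, Fin (n a + 1)) ℂ}
    (hz : IsHomogeneousRows z) (m s : ℕ) : IsHomogeneousRows (upperFlag m s z) := by
  intro k
  obtain ⟨d, hd⟩ := hz (m + k)
  refine ⟨d, fun r => ?_⟩
  unfold RayVar.upperFlag
  split_ifs <;> exact hd _

theorem IsHomogeneousRows.glueFlag {b z : ℕ → ℕ → MvPolynomial (Σ a, Fin (n a + 1)) ℂ}
    (hb : IsHomogeneousRows b) (hz : IsHomogeneousRows z) (m s : ℕ) :
    IsHomogeneousRows (glueFlag m s b z) := by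
  intro k
  by_cases hk : k < m
  · simpa only [RayVar.glueFlag, if_pos hk] using hb k
  · obtain ⟨d, hd⟩ := hb m
    obtain ⟨e, he⟩ := hz (k - m)
    refine ⟨d + e, fun r => ?_⟩
    rw [RayVar.glueFlag, if_neg hk]
    split_ifs
    · rw [mul_comm]
      exact (hd _).mul (he _)
    · exact (hd _).mul (he _)

theorem IsHomogeneousRows.twist {b : ℕ → MvPolynomial (Σ a, Fin (n a + 1)) ℂ}
    {w : ℕ → ℕ → MvPolynomial (Σ a, Fin (n a + 1)) ℂ}
    (hb : ∃ d, ∀ r, IsMultiHomogeneous (b r) d) (hw : IsHomogeneousRows w) (s : ℕ) :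
    IsHomogeneousRows (twist s b w) := by
  intro k
  rcases Nat.eq_zero_or_pos k with rfl | hk
  · exact ⟨0, fun r => by simpa [RayVar.twist] using isMultiHomogeneous_one⟩
  · obtain ⟨d, hd⟩ := hb
    obtain ⟨e, he⟩ := hw k
    refine ⟨d + e, fun r => ?_⟩
    rw [RayVar.twist, if_neg hk.ne']
    split_ifs
    exacts [(hd _).mul (he _), ((hd _).mul (he _)).add ((hd _).mul (he _)), (hd _).mul (he _)]

theorem IsHomogeneousRows.untwist {b : ℕ → MvPolynomial (Σ a, Fin (n a + 1)) ℂ}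
    {w : ℕ → ℕ → MvPolynomial (Σ a, Fin (n a + 1)) ℂ}
    (hb : ∃ d, ∀ r, IsMultiHomogeneous (b r) d) (hw : IsHomogeneousRows w) (s : ℕ) :
    IsHomogeneousRows (untwist s b w) := by
  intro k
  rcases Nat.eq_zero_or_pos k with rfl | hk
  · exact ⟨0, fun r => by simpa [RayVar.untwist] using isMultiHomogeneous_one⟩
  · obtain ⟨d, hd⟩ := hb
    obtain ⟨e, he⟩ := hw k
    refine ⟨d + e, fun r => ?_⟩
    rw [RayVar.untwist, if_neg hk.ne']
    split_ifs
    exacts [((hd _).mul (he _)).sub ((hd _).mul (he _)), (hd _).mul (he _), (hd _).mul (he _)]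

theorem isHomogeneousRows_lineFlag {b : ℕ → MvPolynomial (Σ a, Fin (n a + 1)) ℂ}
    (hb : ∃ d, ∀ r, IsMultiHomogeneous (b r) d) : IsHomogeneousRows (lineFlag b) := by
  intro k
  rcases Nat.eq_zero_or_pos k with rfl | hk
  · exact ⟨0, fun r => by simpa [lineFlag] using isMultiHomogeneous_one⟩
  · simpa only [lineFlag, if_neg hk.ne'] using hb

theorem evalVec_truncate {l : ℕ} (z : ℕ → ℕ → MvPolynomial (Σ a, Fin (n a + 1)) ℂ)
    (v : ∀ a, Fin (n a + 1) → ℂ) :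
    evalVec (m := fun k : Fin (l + 1) => (k : ℕ)) (truncate z) v =
      truncate fun k r => MvPolynomial.eval (fun s => v s.1 s.2) (z k r) :=
  rfl

/-- The dimensions of the factors of the product of projective spaces containing `BF_n`. -/
abbrev flagDim (n : ℕ) : Fin (n + 1) → ℕ := fun k => k

/-- The dimensions of the factors of the product of projective spaces containing `R_{i,j}`. -/
abbrev rayDim (i j : ℕ) : Fin (i + 1) ⊕ Fin (j + 1) → ℕ := Sum.elim (flagDim i) (flagDim j)

theorem eval_extendRow_vars {ι : Type} {n : ι → ℕ} {l : ℕ} {a : ι}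
    (f : Fin (l + 1) → Fin (n a + 1)) (v : ∀ a, Fin (n a + 1) → ℂ) (r : ℕ) :
    MvPolynomial.eval (fun s => v s.1 s.2) (extendRow (fun k => vars n a (f k)) r) =
      extendRow (fun k => v a (f k)) r := by
  rw [map_extendRow]
  simp only [eval_vars]

/-- The homogeneous coordinates of the first factor `ℙ^1`, extended by zero. -/
noncomputable def lineVars {κ : Type} (q : κ → ℕ) :
    ℕ → MvPolynomial (Σ c, Fin (Sum.elim (fun _ : Unit => 1) q c + 1)) ℂ :=
  extendRow fun k : Fin (1 + 1) => vars (Sum.elim (fun _ : Unit => 1) q) (Sum.inl ()) k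

theorem exists_isMultiHomogeneous_lineVars {κ : Type} (q : κ → ℕ) :
    ∃ d, ∀ r, IsMultiHomogeneous (lineVars q r) d :=
  exists_isMultiHomogeneous_extendRow (n := Sum.elim _ _) (a := Sum.inl ()) fun r => r

theorem eval_lineVars {κ : Type} {q : κ → ℕ} (u : Unit → Fin (1 + 1) → ℂ)
    (w : ∀ c, Fin (q c + 1) → ℂ) (r : ℕ) :
    MvPolynomial.eval (fun t => sumVec (n := fun _ : Unit => 1) u w t.1 t.2) (lineVars q r) =
      extendRow (u ()) r :=
  eval_extendRow_vars (n := Sum.elim _ _) (a := Sum.inl ()) (fun r => r) _ r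

/-- The coordinates of the blocks `e 0, …, e l` of `v`, whose sizes are those of a bounded flag. -/
def flagCoords {ι A : Type*} [CommRing A] {n : ι → ℕ} {l : ℕ} (e : Fin (l + 1) → ι)
    (he : ∀ k, n (e k) = k) (v : ∀ a, Fin (n a + 1) → A) : ℕ → ℕ → A :=
  extend fun k r => v (e k) (Fin.cast (by rw [he]) r)

theorem isHomogeneousRows_flagCoords {ι : Type} {n : ι → ℕ} {l : ℕ} (e : Fin (l + 1) → ι)
    (he : ∀ k, n (e k) = k) : IsHomogeneousRows (flagCoords e he (vars n)) :=
  isHomogeneousRows_extend _ _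

theorem eval_flagCoords {ι : Type} {n : ι → ℕ} {l : ℕ} (e : Fin (l + 1) → ι)
    (he : ∀ k, n (e k) = k) (v : ∀ a, Fin (n a + 1) → ℂ) :
    (fun k r => MvPolynomial.eval (fun s => v s.1 s.2) (flagCoords e he (vars n) k r)) =
      flagCoords e he v := by
  funext k r
  rw [flagCoords, map_extend]
  simp only [eval_vars]
  rfl

theorem eval_flagCoords_apply {ι : Type} {n : ι → ℕ} {l : ℕ} (e : Fin (l + 1) → ι)
    (he : ∀ k, n (e k) = k) (v : ∀ a, Fin (n a + 1) → ℂ) (k r : ℕ) :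
    MvPolynomial.eval (fun s => v s.1 s.2) (flagCoords e he (vars n) k r) =
      flagCoords e he v k r :=
  congrFun (congrFun (eval_flagCoords e he v) k) r

section Evaluation

variable {ι : Type} {n : ι → ℕ} {l l' l'' : ℕ} (e : Fin (l + 1) → ι) (he : ∀ k, n (e k) = k)
  (e' : Fin (l' + 1) → ι) (he' : ∀ k, n (e' k) = k) (v : ∀ a, Fin (n a + 1) → ℂ)

theorem evalVec_flagCoords : evalVec (m := flagDim l'')
    (truncate (flagCoords e he (vars n))) v = truncate (flagCoords e he v) := by
  rw [evalVec_truncate, eval_flagCoords]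

theorem evalVec_upperFlag (m s : ℕ) : evalVec (m := flagDim l'')
    (truncate (upperFlag m s (flagCoords e he (vars n)))) v =
      truncate (upperFlag m s (flagCoords e he v)) := by
  simp only [evalVec_truncate, map_upperFlag, eval_flagCoords]

theorem evalVec_glueFlag (m s : ℕ) : evalVec (m := flagDim l'')
    (truncate (glueFlag m s (flagCoords e he (vars n)) (flagCoords e' he' (vars n)))) v =
      truncate (glueFlag m s (flagCoords e he v) (flagCoords e' he' v)) := by
  simp only [evalVec_truncate, map_glueFlag, eval_flagCoords]

theorem evalVec_twist {b : ℕ → MvPolynomial (Σ a, Fin (n a + 1)) ℂ} {b₀ : ℕ → ℂ}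
    (hb : ∀ r, MvPolynomial.eval (fun s => v s.1 s.2) (b r) = b₀ r) (s : ℕ) :
    evalVec (m := flagDim l'') (truncate (twist s b (flagCoords e he (vars n)))) v =
      truncate (twist s b₀ (flagCoords e he v)) := by
  simp only [evalVec_truncate, map_twist, eval_flagCoords, hb]

theorem evalVec_untwist {b : ℕ → MvPolynomial (Σ a, Fin (n a + 1)) ℂ} {b₀ : ℕ → ℂ}
    (hb : ∀ r, MvPolynomial.eval (fun s => v s.1 s.2) (b r) = b₀ r) (s : ℕ) :
    evalVec (m := flagDim l'') (truncate (untwist s b (flagCoords e he (vars n)))) v =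
      truncate (untwist s b₀ (flagCoords e he v)) := by
  simp only [evalVec_truncate, map_untwist, eval_flagCoords, hb]

theorem evalVec_glueFlag_lineFlag {b : ℕ → MvPolynomial (Σ a, Fin (n a + 1)) ℂ} {b₀ : ℕ → ℂ}
    (hb : ∀ r, MvPolynomial.eval (fun s => v s.1 s.2) (b r) = b₀ r) (m s : ℕ) :
    evalVec (m := flagDim l'')
      (truncate (glueFlag m s (lineFlag b) (flagCoords e he (vars n)))) v =
      truncate (glueFlag m s (lineFlag b₀) (flagCoords e he v)) := by
  simp only [evalVec_truncate, map_glueFlag, map_lineFlag, eval_flagCoords, hb]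

end Evaluation

end Systems

/-! ### The three fibre bundles -/

/-- On the chart `z_{m,s} ≠ 0`, the first flag is replaced by its part above `l_m`, and the second
stays the same. -/
theorem isAlgFibreBundle_forget {m i j : ℕ} (hi : i = m + (j + 1)) (h : m ≤ i) :
    IsAlgFibreBundle (E := R i j) (B := BF m) (fun x => BF.forget h ⟨x.1.fst, x.2.1⟩)
      (R (j + 1) j) := by
  subst hi
  obtain ⟨P, hPh, hP⟩ : ∃ P : PolySystem (rayDim (m + (j + 1)) j) (flagDim m),
      IsHomogeneousSystem P ∧ ∀ v, evalVec P v = truncate (extend fun k => v (Sum.inl k)) :=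
    ⟨_, (isHomogeneousRows_flagCoords Sum.inl fun _ => rfl).truncate m,
      fun v => evalVec_flagCoords _ _ v⟩
  refine isAlgFibreBundle_of_systems (isCone_R _ _) (isCone_BF m) (isCone_R _ _) hPh
    (fun x => ?_) (fun v hv => ?_) fun b _ => ?_
  · rw [hP]
    funext k r
    exact extend_val (n := m + (j + 1)) x.1.fst.coord (Fin.castLE (by omega) k) r
  · rw [hP]
    exact (hv.left.restrict h).of_scaledBelow (scaledBelow_extend_truncate _ _)
  obtain ⟨s, hs⟩ := Function.ne_iff.1 (b (Fin.last m)).rep_nonzero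
  have hsm : (s : ℕ) ≤ m := Nat.le_of_lt_succ s.2
  -- the coordinates on the fibre
  obtain ⟨Q, hQh, hQ⟩ : ∃ Q : PolySystem (rayDim (m + (j + 1)) j) (rayDim (j + 1) j),
      IsHomogeneousSystem Q ∧ ∀ v, evalVec Q v =
        sumVec (truncate (upperFlag m s (extend fun k => v (Sum.inl k))))
          (truncate (extend fun k => v (Sum.inr k))) :=
    ⟨_, (((isHomogeneousRows_flagCoords Sum.inl fun _ => rfl).upperFlag m s).truncate _).sumVec
      ((isHomogeneousRows_flagCoords Sum.inr fun _ => rfl).truncate _),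
      fun v => (evalVec_sumVec _ _ v).trans
        (congrArg₂ sumVec (evalVec_upperFlag _ _ v m s) (evalVec_flagCoords _ _ v))⟩
  -- the inverse of the trivialisation
  obtain ⟨G, hGh, hG⟩ : ∃ G : PolySystem (Sum.elim (flagDim m) (rayDim (j + 1) j))
        (rayDim (m + (j + 1)) j),
      IsHomogeneousSystem G ∧ ∀ (u : ∀ k : Fin (m + 1), Fin ((k : ℕ) + 1) → ℂ) w,
        evalVec G (sumVec u w) =
          sumVec (truncate (glueFlag m s (extend u) (extend fun k => w (Sum.inl k))))
            (truncate (extend fun k => w (Sum.inr k))) :=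
    ⟨_, (((isHomogeneousRows_flagCoords Sum.inl fun _ => rfl).glueFlag
        (isHomogeneousRows_flagCoords (Sum.inr ∘ Sum.inl) fun _ => rfl) m s).truncate _).sumVec
      ((isHomogeneousRows_flagCoords (Sum.inr ∘ Sum.inr) fun _ => rfl).truncate _),
      fun u w => (evalVec_sumVec _ _ _).trans
        (congrArg₂ sumVec (evalVec_glueFlag _ _ _ _ _ m s) (evalVec_flagCoords _ _ _))⟩
  refine ⟨Fin.last m, s, hs, Q, G, hQh, hGh, fun v hv h0 => ?_, fun u w hu h0 hw => ?_⟩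
  · rw [hP] at h0 ⊢
    rw [hQ]
    refine ⟨(hv.upperFlag hsm h0).of_scaledBelow (scaledBelow_extend_truncate _ _)
      (scaledBelow_extend_truncate _ _), ?_⟩
    rw [hG]
    rintro (k | k)
    · exact exists_truncate_eq_smul ((EqBelow.glueFlag hsm (extend_truncate _)
        (extend_truncate (n := j + 1) _)).exists_mul (Nat.le_of_lt_succ k.2)
        (glueFlag_upperFlag hv.left hsm (Nat.le_of_lt_succ k.2)))
    · exact exists_truncate_eq_smul ((extend_truncate _).exists_mul (Nat.le_of_lt_succ k.2)
        ⟨1, fun r _ => (one_mul _).symm⟩)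
  · replace h0 : extend u m s ≠ 0 := by
      rwa [← extend_val u (Fin.last m) s] at h0
    rw [hG, hP, hQ]
    refine ⟨(hw.glueFlag hu hsm h0).of_scaledBelow (scaledBelow_extend_truncate _ _)
      (scaledBelow_extend_truncate _ _), fun k => ?_, ?_⟩
    · exact exists_truncate_eq_smul ((extend_truncate (n := m + (j + 1)) _).exists_mul
        ((Nat.le_of_lt_succ k.2).trans h) (glueFlag_lower _ _ (Nat.le_of_lt_succ k.2)))
    rintro (k | k)
    · exact exists_truncate_eq_smul
        ((EqBelow.upperFlag hsm (extend_truncate (n := m + (j + 1)) _)).exists_mul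
          (Nat.le_of_lt_succ k.2) ⟨extend u m s, fun r _ => upperFlag_glueFlag _ _ hsm k r⟩)
    · exact exists_truncate_eq_smul ((extend_truncate _).exists_mul (Nat.le_of_lt_succ k.2)
        ⟨1, fun r _ => (one_mul _).symm⟩)

/-- On the chart `z_{1,s} ≠ 0`, the first flag is replaced by its part above `l_1`, and the second
is transformed by `twist`. -/
theorem isAlgFibreBundle_projZ1 (n : ℕ) (hn : 1 ≤ n + 1) :
    IsAlgFibreBundle (projZ1 (n + 1) hn) (R n (n + 1)) := by
  obtain ⟨P, hPh, hP⟩ : ∃ P : PolySystem (rayDim (n + 1) (n + 1)) (fun _ : Unit => 1),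
      IsHomogeneousSystem P ∧
        ∀ v, evalVec P v = fun _ (r : Fin (1 + 1)) => extend (fun k => v (Sum.inl k)) 1 r := by
    refine ⟨fun _ r => flagCoords Sum.inl (fun _ => rfl) (vars _) 1 r, fun _ => ?_, fun v => ?_⟩
    · obtain ⟨d, hd⟩ := isHomogeneousRows_flagCoords (n := rayDim (n + 1) (n + 1)) Sum.inl
        (fun _ => rfl) 1
      exact ⟨d, fun r => hd r⟩
    · funext _ r
      exact eval_flagCoords_apply Sum.inl (fun _ => rfl) v 1 r
  refine isAlgFibreBundle_of_systems (isCone_R _ _) isCone_P1 (isCone_R _ _) hPh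
    (fun x => ?_) (fun v hv => ?_) fun b _ => ?_
  · rw [hP]
    funext _ r
    exact extend_val (n := n + 1) x.1.fst.coord ⟨1, Nat.lt_succ_of_le hn⟩ r
  · rw [hP]
    obtain ⟨r, hr, h0⟩ := hv.left.ne_zero 1 hn
    exact fun h => h0 (congrFun h ⟨r, Nat.lt_succ_of_le hr⟩)
  obtain ⟨s, hs⟩ := Function.ne_iff.1 (b ()).rep_nonzero
  have hsm : (s : ℕ) ≤ 1 := Nat.le_of_lt_succ s.2
  -- the coordinates on the fibre
  obtain ⟨Q, hQh, hQ⟩ : ∃ Q : PolySystem (rayDim (n + 1) (n + 1)) (rayDim n (n + 1)),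
      IsHomogeneousSystem Q ∧ ∀ v, evalVec Q v = sumVec
        (truncate (upperFlag 1 s (extend fun k => v (Sum.inl k))))
        (truncate (twist s (extend (fun k => v (Sum.inl k)) 1) (extend fun k => v (Sum.inr k)))) :=
    ⟨_, IsHomogeneousSystem.sumVec
      (((isHomogeneousRows_flagCoords Sum.inl fun _ => rfl).upperFlag 1 s).truncate _)
      ((IsHomogeneousRows.twist (isHomogeneousRows_flagCoords Sum.inl (fun _ => rfl) 1)
        (isHomogeneousRows_flagCoords Sum.inr fun _ => rfl) s).truncate _),
      fun v => (evalVec_sumVec _ _ v).trans (congrArg₂ sumVec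
        (evalVec_upperFlag _ _ v 1 s)
        (evalVec_twist _ _ v (eval_flagCoords_apply Sum.inl (fun _ => rfl) v 1) s))⟩
  -- the inverse of the trivialisation; the point `u` of `ℙ^1` is the line `l_1` of the split flag
  obtain ⟨G, hGh, hG⟩ : ∃ G : PolySystem (Sum.elim (fun _ : Unit => 1) (rayDim n (n + 1)))
        (rayDim (n + 1) (n + 1)),
      IsHomogeneousSystem G ∧ ∀ (u : Unit → Fin (1 + 1) → ℂ) w,
        evalVec G (sumVec u w) = sumVec
          (truncate (glueFlag 1 s (lineFlag (extendRow (u ()))) (extend fun k => w (Sum.inl k))))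
          (truncate (untwist s (extendRow (u ())) (extend fun k => w (Sum.inr k)))) :=
    ⟨_, IsHomogeneousSystem.sumVec
      (((isHomogeneousRows_lineFlag
        (exists_isMultiHomogeneous_lineVars (rayDim n (n + 1)))).glueFlag
        (isHomogeneousRows_flagCoords (Sum.inr ∘ Sum.inl) fun _ => rfl) 1 s).truncate _)
      ((IsHomogeneousRows.untwist (exists_isMultiHomogeneous_lineVars _)
        (isHomogeneousRows_flagCoords (Sum.inr ∘ Sum.inr) fun _ => rfl) s).truncate _),
      fun u w => (evalVec_sumVec _ _ _).trans (congrArg₂ sumVec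
        (evalVec_glueFlag_lineFlag _ _ _ (eval_lineVars u w) 1 s)
        (evalVec_untwist _ _ _ (eval_lineVars u w) s))⟩
  refine ⟨(), s, hs, Q, G, hQh, hGh, fun v hv h0 => ?_, fun u w _ h0 hw => ?_⟩
  · rw [hP] at h0 ⊢
    rw [hQ]
    have hu : ∀ r ≤ 1, extendRow (fun r : Fin (1 + 1) => extend (fun k => v (Sum.inl k)) 1 r) r =
        extend (fun k => v (Sum.inl k)) 1 r :=
      fun r hr => extendRow_val (n := 1) _ ⟨r, Nat.lt_succ_of_le hr⟩
    refine ⟨(hv.upperFlag_twist hsm h0).of_scaledBelow (scaledBelow_extend_truncate _ _)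
      (scaledBelow_extend_truncate _ _), ?_⟩
    rw [hG]
    rintro (k | k)
    · exact exists_truncate_eq_smul (glueFlag_lineFlag_upperFlag hv.left hsm hu
        (extend_truncate (n := n) _) (Nat.le_of_lt_succ k.2))
    · exact exists_truncate_eq_smul ((EqBelow.untwist hsm hu
        (extend_truncate (n := n + 1) _)).exists_mul (Nat.le_of_lt_succ k.2)
        (untwist_twist hv.right hsm _ k))
  · replace h0 : extendRow (u ()) s ≠ 0 := by
      rwa [← extendRow_val (u ()) s] at h0
    rw [hG, hP, hQ]
    have hz := extend_truncate (n := n + 1)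
      (glueFlag 1 s (lineFlag (extendRow (u ()))) (extend fun k => w (Sum.inl k)))
    have hz' : EqBelow (1 + n) _ _ := fun k hk => hz k (by omega)
    refine ⟨(hw.glueFlag_untwist hsm h0).of_scaledBelow (scaledBelow_extend_truncate _ _)
      (scaledBelow_extend_truncate _ _), fun _ => ⟨extend (fun k => w (Sum.inl k)) 0 0, ?_⟩, ?_⟩
    · funext r
      have hr : (r : ℕ) ≤ 1 := Nat.le_of_lt_succ r.2
      refine (hz 1 (by omega) r hr).trans ((glueFlag_lineFlag_one _ _ hr).trans ?_)
      rw [extendRow_val]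
      rfl
    rintro (k | k)
    · exact exists_truncate_eq_smul ((EqBelow.upperFlag hsm hz').exists_mul
        (Nat.le_of_lt_succ k.2) ⟨lineFlag (extendRow (u ())) 1 s,
          fun r _ => upperFlag_glueFlag _ _ hsm k r⟩)
    · obtain ⟨c, -, hc⟩ := scaledBelow_twist_untwist hw.left.zero_zero_ne_zero
        (fun r hr => (hz 1 (by omega) r hr).trans (glueFlag_lineFlag_one _ _ hr))
        hw.right hsm h0 k (Nat.le_of_lt_succ k.2)
      exact exists_truncate_eq_smul ((EqBelow.twist hsm (fun _ _ => rfl)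
        (extend_truncate (n := n + 1) _)).exists_mul (Nat.le_of_lt_succ k.2) ⟨c, hc⟩)

/-- The same trivialisation as for `projZ1`, with the two flags exchanged. -/
theorem isAlgFibreBundle_projW1 (n : ℕ) (hn : 1 ≤ n + 1) :
    IsAlgFibreBundle (projW1 (n + 1) hn) (R (n + 1) n) := by
  obtain ⟨P, hPh, hP⟩ : ∃ P : PolySystem (rayDim (n + 1) (n + 1)) (fun _ : Unit => 1),
      IsHomogeneousSystem P ∧
        ∀ v, evalVec P v = fun _ (r : Fin (1 + 1)) => extend (fun k => v (Sum.inr k)) 1 r := by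
    refine ⟨fun _ r => flagCoords Sum.inr (fun _ => rfl) (vars _) 1 r, fun _ => ?_, fun v => ?_⟩
    · obtain ⟨d, hd⟩ := isHomogeneousRows_flagCoords (n := rayDim (n + 1) (n + 1)) Sum.inr
        (fun _ => rfl) 1
      exact ⟨d, fun r => hd r⟩
    · funext _ r
      exact eval_flagCoords_apply Sum.inr (fun _ => rfl) v 1 r
  refine isAlgFibreBundle_of_systems (isCone_R _ _) isCone_P1 (isCone_R _ _) hPh
    (fun x => ?_) (fun v hv => ?_) fun b _ => ?_
  · rw [hP]
    funext _ r
    exact extend_val (n := n + 1) x.1.snd.coord ⟨1, Nat.lt_succ_of_le hn⟩ r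
  · replace hv := hv.swap
    rw [hP]
    obtain ⟨r, hr, h0⟩ := hv.left.ne_zero 1 hn
    exact fun h => h0 (congrFun h ⟨r, Nat.lt_succ_of_le hr⟩)
  obtain ⟨s, hs⟩ := Function.ne_iff.1 (b ()).rep_nonzero
  have hsm : (s : ℕ) ≤ 1 := Nat.le_of_lt_succ s.2
  -- the coordinates on the fibre
  obtain ⟨Q, hQh, hQ⟩ : ∃ Q : PolySystem (rayDim (n + 1) (n + 1)) (rayDim (n + 1) n),
      IsHomogeneousSystem Q ∧ ∀ v, evalVec Q v = sumVec
        (truncate (twist s (extend (fun k => v (Sum.inr k)) 1) (extend fun k => v (Sum.inl k))))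
        (truncate (upperFlag 1 s (extend fun k => v (Sum.inr k)))) :=
    ⟨_, IsHomogeneousSystem.sumVec
      ((IsHomogeneousRows.twist (isHomogeneousRows_flagCoords Sum.inr (fun _ => rfl) 1)
        (isHomogeneousRows_flagCoords Sum.inl fun _ => rfl) s).truncate _)
      (((isHomogeneousRows_flagCoords Sum.inr fun _ => rfl).upperFlag 1 s).truncate _),
      fun v => (evalVec_sumVec _ _ v).trans (congrArg₂ sumVec
        (evalVec_twist _ _ v (eval_flagCoords_apply Sum.inr (fun _ => rfl) v 1) s)
        (evalVec_upperFlag _ _ v 1 s))⟩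
  -- the inverse of the trivialisation; the point `u` of `ℙ^1` is the line `l_1` of the split flag
  obtain ⟨G, hGh, hG⟩ : ∃ G : PolySystem (Sum.elim (fun _ : Unit => 1) (rayDim (n + 1) n))
        (rayDim (n + 1) (n + 1)),
      IsHomogeneousSystem G ∧ ∀ (u : Unit → Fin (1 + 1) → ℂ) w,
        evalVec G (sumVec u w) = sumVec
          (truncate (untwist s (extendRow (u ())) (extend fun k => w (Sum.inl k))))
          (truncate (glueFlag 1 s (lineFlag (extendRow (u ()))) (extend fun k => w (Sum.inr k)))) :=
    ⟨_, IsHomogeneousSystem.sumVec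
      ((IsHomogeneousRows.untwist (exists_isMultiHomogeneous_lineVars _)
        (isHomogeneousRows_flagCoords (Sum.inr ∘ Sum.inl) fun _ => rfl) s).truncate _)
      (((isHomogeneousRows_lineFlag
        (exists_isMultiHomogeneous_lineVars (rayDim (n + 1) n))).glueFlag
        (isHomogeneousRows_flagCoords (Sum.inr ∘ Sum.inr) fun _ => rfl) 1 s).truncate _),
      fun u w => (evalVec_sumVec _ _ _).trans (congrArg₂ sumVec
        (evalVec_untwist _ _ _ (eval_lineVars u w) s)
        (evalVec_glueFlag_lineFlag _ _ _ (eval_lineVars u w) 1 s))⟩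
  refine ⟨(), s, hs, Q, G, hQh, hGh, fun v hv h0 => ?_, fun u w _ h0 hw => ?_⟩
  · replace hv := hv.swap
    rw [hP] at h0 ⊢
    rw [hQ]
    have hu : ∀ r ≤ 1, extendRow (fun r : Fin (1 + 1) => extend (fun k => v (Sum.inr k)) 1 r) r =
        extend (fun k => v (Sum.inr k)) 1 r :=
      fun r hr => extendRow_val (n := 1) _ ⟨r, Nat.lt_succ_of_le hr⟩
    refine ⟨(hv.upperFlag_twist hsm h0).swap.of_scaledBelow (scaledBelow_extend_truncate _ _)
      (scaledBelow_extend_truncate _ _), ?_⟩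
    rw [hG]
    rintro (k | k)
    · exact exists_truncate_eq_smul ((EqBelow.untwist hsm hu
        (extend_truncate (n := n + 1) _)).exists_mul (Nat.le_of_lt_succ k.2)
        (untwist_twist hv.right hsm _ k))
    · exact exists_truncate_eq_smul (glueFlag_lineFlag_upperFlag hv.left hsm hu
        (extend_truncate (n := n) _) (Nat.le_of_lt_succ k.2))
  · replace hw := hw.swap
    replace h0 : extendRow (u ()) s ≠ 0 := by
      rwa [← extendRow_val (u ()) s] at h0
    rw [hG, hP, hQ]
    have hz := extend_truncate (n := n + 1)
      (glueFlag 1 s (lineFlag (extendRow (u ()))) (extend fun k => w (Sum.inr k)))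
    have hz' : EqBelow (1 + n) _ _ := fun k hk => hz k (by omega)
    refine ⟨(hw.glueFlag_untwist hsm h0).swap.of_scaledBelow (scaledBelow_extend_truncate _ _)
      (scaledBelow_extend_truncate _ _), fun _ => ⟨extend (fun k => w (Sum.inr k)) 0 0, ?_⟩, ?_⟩
    · funext r
      have hr : (r : ℕ) ≤ 1 := Nat.le_of_lt_succ r.2
      refine (hz 1 (by omega) r hr).trans ((glueFlag_lineFlag_one _ _ hr).trans ?_)
      rw [extendRow_val]
      rfl
    rintro (k | k)
    · obtain ⟨c, -, hc⟩ := scaledBelow_twist_untwist hw.left.zero_zero_ne_zero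
        (fun r hr => (hz 1 (by omega) r hr).trans (glueFlag_lineFlag_one _ _ hr))
        hw.right hsm h0 k (Nat.le_of_lt_succ k.2)
      exact exists_truncate_eq_smul ((EqBelow.twist hsm (fun _ _ => rfl)
        (extend_truncate (n := n + 1) _)).exists_mul (Nat.le_of_lt_succ k.2) ⟨c, hc⟩)
    · exact exists_truncate_eq_smul ((EqBelow.upperFlag hsm hz').exists_mul
        (Nat.le_of_lt_succ k.2) ⟨lineFlag (extendRow (u ())) 1 s,
          fun r _ => upperFlag_glueFlag _ _ hsm k r⟩)

end RayVar

theorem mainTheorem10 :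
    (∀ i j : ℕ, j + 1 ≤ i →
      RayVar.IsAlgFibreBundle (RayVar.projBF i j) (RayVar.R (j + 1) j)) ∧
    (∀ (i : ℕ) (hi : 1 ≤ i),
      RayVar.IsAlgFibreBundle (RayVar.projZ1 i hi) (RayVar.R (i - 1) i) ∧
      RayVar.IsAlgFibreBundle (RayVar.projW1 i hi) (RayVar.R i (i - 1))) := by
  refine ⟨fun i j h => RayVar.isAlgFibreBundle_forget (by omega) (by omega), fun i hi => ?_⟩
  obtain ⟨n, rfl⟩ := Nat.exists_eq_succ_of_ne_zero (Nat.one_le_iff_ne_zero.1 hi)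
  exact ⟨RayVar.isAlgFibreBundle_projZ1 n hi, RayVar.isAlgFibreBundle_projW1 n hi⟩
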